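/- Let $\mathbb F$ be $\mathbb R$ or $\mathbb C$ and $m\ge 1$. Put $d_{\mathbb R^m}=\frac{m(m+1)}2-1$, $d_{\mathbb C^m}=m^2-1$, $k_{\mathbb R^m}=\frac m2+1$, $k_{\mathbb C^m}=m+1$. Definitions. Fix a linear isometry $\mathcal V$ from the real vector space of trace-zero Hermitian (symmetric if $\mathbb F=\mathbb R$) $m\times m$ matrices over $\mathbb F$ with inner product $\operatorname{tr}(AB)$ onto $\mathbb R^{d_{\mathbb F^m}}$. The embedded vector of an orthogonal projection $P$ on $\mathbb F^m$ of rank $l$, $0<l<m$, is $v_P=\mathcal V\bigl(P-\tfrac lm I_m\bigr)\big/\sqrt{l(m-l)/m}$. A finite family $\{P_i\}$ of orthogonal projections on $\mathbb F^m$ is of constant rank if exactly one rank occurs in it; it is a fusion frame if $\sum_i P_i$ is positive definite; it is a maximal orthoplectic fusion frame for $\mathbb F^m$ if it consists of $2d_{\mathbb F^m}$ projections and its embedded vectors form an orthoplex in $\mathbb R^{d_{\mathbb F^m}}$, that is, they are the vectors of an orthonormal basis together with their negatives. A family $\{\mathcal B_k\}_{k\in K}$ of orthonormal bases of $\mathbb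 F^m$ is a set of mutually unbiased bases (MUBs) if $|\langle b,b'\rangle|^2=\frac1m$ for all $b\in\mathcal B_k$, $b'\in\mathcal B_{k'}$, $k\ne k'$; it is maximal if $|K|=k_{\mathbb F^m}$. For an orthonormal basis $\mathcal B=\{b_j\}_{j=1}^m$ and $\mathcal J\subseteq[m]=\{1,\dots,m\}$, the coordinate projection is $P^{\mathcal B}_{\mathcal J}=\sum_{j\in\mathcal J}b_jb_j^*$. A Hadamard 3-design on $[m]$ is a set $\mathbb S$ of subsets (blocks) of $[m]$ such that for some integer $t\ge1$: $m=4t$, every block has $2t$ elements, every 3-subset of $[m]$ lies in exactly $t-1$ blocks, every point lies in the same number of blocks, and $|\mathbb S|=8t-2$ (the last condition is automatic if $t\ge2$; if $t=1$, it says that $\mathbb S$ consists of all 2-subsets of $[4]$). Theorem. Let $\mathbb S$ be a set of subsets of $[m]$, each of size $l$, let $\{\mathcal B_k\}_{k\in K}$ be a maximal set of MUBs for $\mathbb F^m$, and let $\mathcal P=\{P^{\mathcal B_k}_{\mathcal J}: k\in K,\ \mathcal J\in\mathbb S\}$. If $\mathbb S$ is a Hadamard 3-design, then $\mathcal P$ is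 a maximal orthoplectic fusion frame of constant rank for $\mathbb F^m$ (in particular, a fusion frame). Conversely, if $m>2$ and $\mathcal P$ is a maximal orthoplectic fusion frame of constant rank for $\mathbb F^m$, then $\mathbb S$ is a Hadamard 3-design. In particular: 1. If $m\ge4$ is a power of $2$, then Hadamard 3-designs on $[m]$ exist, and there is a maximal set of MUBs for $\mathbb C^m$ such that for every Hadamard 3-design $\mathbb S$ on $[m]$ the family $\mathcal P$ is a maximal orthoplectic fusion frame of constant rank for $\mathbb C^m$. 2. If $m\ge4$ is a power of $4$, then Hadamard 3-designs on $[m]$ exist, and there is a maximal set of MUBs for $\mathbb R^m$ such that for every Hadamard 3-design $\mathbb S$ on $[m]$ the family $\mathcal P$ is a maximal orthoplectic fusion frame of constant rank for $\mathbb R^m$. -/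

import Mathlib

open scoped ComplexOrder

noncomputable section

namespace OrthoplecticFrames

/-! ### Packings of orthogonal projections -/

/-- The orthogonal projections on `𝕜 ^ m`, as Hermitian idempotent `m × m` matrices. -/
abbrev OrthProj (𝕜 : Type*) [RCLike 𝕜] (m : ℕ) : Type _ :=
  {P : Matrix (Fin m) (Fin m) 𝕜 // IsStarProjection P}

/-- A packing is a finite family `P : ι → OrthProj 𝕜 m`; its mixture is the number of different
ranks that occur. -/
def mixture {𝕜 : Type*} [RCLike 𝕜] {m : ℕ} {ι : Type*} [Fintype ι] (P : ι → OrthProj 𝕜 m) : ℕ :=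
  (Finset.univ.image fun i => (P i).1.rank).card

/-- A packing is of constant rank if exactly one rank occurs. -/
def IsConstantRank {𝕜 : Type*} [RCLike 𝕜] {m : ℕ} {ι : Type*} [Fintype ι]
    (P : ι → OrthProj 𝕜 m) : Prop :=
  mixture P = 1

/-- A packing is a fusion frame if its fusion frame operator `∑ i, P i` is positive definite. -/
def IsFusionFrame {𝕜 : Type*} [RCLike 𝕜] {m : ℕ} {ι : Type*} [Fintype ι]
    (P : ι → OrthProj 𝕜 m) : Prop :=
  (∑ i, (P i).1).PosDef

/-! ### The embedding of projections into a Euclidean sphere -/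

/-- The dimension `m (m + 1) / 2 - 1` over the reals and `m ^ 2 - 1` over the complex numbers.
(Up to isomorphism these are the only two instances of `RCLike`; the real dimension of `𝕜` tells
them apart.) -/
def embDim (𝕜 : Type*) [RCLike 𝕜] (m : ℕ) : ℕ :=
  if Module.finrank ℝ 𝕜 = 1 then m * (m + 1) / 2 - 1 else m ^ 2 - 1

theorem embDim_real (m : ℕ) : embDim ℝ m = m * (m + 1) / 2 - 1 := by
  simp [embDim]

theorem embDim_complex (m : ℕ) : embDim ℂ m = m ^ 2 - 1 := by
  simp [embDim, Complex.finrank_real_complex]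

/-- The real vector space of trace-zero Hermitian (symmetric if `𝕜 = ℝ`) matrices. -/
def tracelessHermitian (𝕜 : Type*) [RCLike 𝕜] (m : ℕ) :
    Submodule ℝ (Matrix (Fin m) (Fin m) 𝕜) where
  carrier := {A | A.IsHermitian ∧ A.trace = 0}
  add_mem' := by
    rintro A B ⟨hA, hA'⟩ ⟨hB, hB'⟩
    exact ⟨hA.add hB, by rw [Matrix.trace_add, hA', hB', add_zero]⟩
  zero_mem' := ⟨Matrix.isHermitian_zero, Matrix.trace_zero _ _⟩
  smul_mem' := by
    rintro c A ⟨hA, hA'⟩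
    refine ⟨?_, by rw [Matrix.trace_smul, hA', smul_zero]⟩
    rw [Matrix.IsHermitian, Matrix.conjTranspose_smul, hA.eq, star_trivial]

theorem trace_eq_rank {𝕜 : Type*} [RCLike 𝕜] {m : ℕ} (P : OrthProj 𝕜 m) :
    P.1.trace = (P.1.rank : 𝕜) := by
  have h : IsIdempotentElem (Matrix.toLin' P.1) := by
    have h0 : P.1 * P.1 = P.1 := P.2.isIdempotentElem
    rw [IsIdempotentElem, Module.End.mul_eq_comp, ← Matrix.toLin'_mul, h0]
  have h2 := (LinearMap.IsIdempotentElem.isProj_range _ h).trace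
  rw [Matrix.trace_toLin'_eq] at h2
  exact h2

/-- The traceless map `P ↦ P - (l / m) I`, where `l` is the rank of `P`. -/
def tracelessMap {𝕜 : Type*} [RCLike 𝕜] {m : ℕ} (P : OrthProj 𝕜 m) : tracelessHermitian 𝕜 m :=
  ⟨P.1 - ((P.1.rank : ℝ) / m) • (1 : Matrix (Fin m) (Fin m) 𝕜), by
    refine ⟨?_, ?_⟩
    · have h1 : P.1.IsHermitian := P.2.isSelfAdjoint
      refine h1.sub ?_
      rw [Matrix.IsHermitian, Matrix.conjTranspose_smul, Matrix.conjTranspose_one, star_trivial]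
    · rw [Matrix.trace_sub, trace_eq_rank, Matrix.trace_smul, Matrix.trace_one, Fintype.card_fin]
      rcases Nat.eq_zero_or_pos m with rfl | hm
      · have h0 : P.1.rank = 0 := by
          have := P.1.rank_le_card_width
          simpa using this
        simp [h0]
      · have hm' : (m : 𝕜) ≠ 0 := by exact_mod_cast hm.ne'
        rw [RCLike.real_smul_eq_coe_mul]
        push_cast
        field_simp
        ring⟩

/-- A linear identification of the trace-zero Hermitian matrices with a Euclidean space that takes
the Hilbert-Schmidt inner product `tr (A B)` to the Euclidean one. -/
def IsHilbertSchmidtIsometry {𝕜 : Type*} [RCLike 𝕜] {m d : ℕ}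
    (V : tracelessHermitian 𝕜 m ≃ₗ[ℝ] EuclideanSpace ℝ (Fin d)) : Prop :=
  ∀ A B : tracelessHermitian 𝕜 m, inner ℝ (V A) (V B) = RCLike.re (A.1 * B.1).trace

/-- The embedded vector of a projection `P` of rank `l`: the image of `P - (l / m) I`, divided by
its Hilbert-Schmidt norm `√(l (m - l) / m)`. -/
def embeddedVector {𝕜 : Type*} [RCLike 𝕜] {m d : ℕ}
    (V : tracelessHermitian 𝕜 m ≃ₗ[ℝ] EuclideanSpace ℝ (Fin d)) (P : OrthProj 𝕜 m) :
    EuclideanSpace ℝ (Fin d) :=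
  (Real.sqrt ((P.1.rank : ℝ) * ((m : ℝ) - P.1.rank) / m))⁻¹ • V (tracelessMap P)

/-- A family of vectors forms an orthoplex in `ℝ ^ d` if its members are exactly the vectors of an
orthonormal basis and their negatives. -/
def FormsOrthoplex {d : ℕ} {ι : Type*} (v : ι → EuclideanSpace ℝ (Fin d)) : Prop :=
  ∃ e : OrthonormalBasis (Fin d) ℝ (EuclideanSpace ℝ (Fin d)),
    Set.range v = Set.range (fun j => e j) ∪ Set.range (fun j => -e j)

/-- Maximal orthoplectic fusion frames: packings of `2 d` projections, `d = embDim 𝕜 m`, whose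
embedded vectors form an orthoplex in `ℝ ^ d`. (Two identifications `V` differ by an orthogonal
transformation of `ℝ ^ d`, so the choice of `V` is immaterial.) -/
def IsMaximalOrthoplectic {𝕜 : Type*} [RCLike 𝕜] {m : ℕ} {ι : Type*} [Fintype ι]
    (P : ι → OrthProj 𝕜 m) : Prop :=
  Fintype.card ι = 2 * embDim 𝕜 m ∧
    ∃ V : tracelessHermitian 𝕜 m ≃ₗ[ℝ] EuclideanSpace ℝ (Fin (embDim 𝕜 m)),
      IsHilbertSchmidtIsometry V ∧ FormsOrthoplex fun i => embeddedVector V (P i)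

/-! ### Mutually unbiased bases and coordinate projections -/

/-- A family of orthonormal bases of `𝕜 ^ m` is mutually unbiased. -/
def IsMUB {𝕜 : Type*} [RCLike 𝕜] {m : ℕ} {K : Type*}
    (B : K → OrthonormalBasis (Fin m) 𝕜 (EuclideanSpace 𝕜 (Fin m))) : Prop :=
  ∀ k k' : K, k ≠ k' → ∀ j j' : Fin m, ‖inner 𝕜 (B k j) (B k' j')‖ ^ 2 = 1 / (m : ℝ)

/-- The cardinality of a maximal set of mutually unbiased bases: `m / 2 + 1` over the reals and
`m + 1` over the complex numbers (a rational number, since `m` may be odd). -/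
def maxMUB (𝕜 : Type*) [RCLike 𝕜] (m : ℕ) : ℚ :=
  if Module.finrank ℝ 𝕜 = 1 then (m : ℚ) / 2 + 1 else (m : ℚ) + 1

theorem maxMUB_real (m : ℕ) : maxMUB ℝ m = (m : ℚ) / 2 + 1 := by
  simp [maxMUB]

theorem maxMUB_complex (m : ℕ) : maxMUB ℂ m = (m : ℚ) + 1 := by
  simp [maxMUB, Complex.finrank_real_complex]

/-- The matrix `∑ j ∈ J, b j (b j)^*`. -/
def coordMatrix {𝕜 : Type*} [RCLike 𝕜] {m : ℕ}
    (b : OrthonormalBasis (Fin m) 𝕜 (EuclideanSpace 𝕜 (Fin m))) (J : Finset (Fin m)) :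
    Matrix (Fin m) (Fin m) 𝕜 :=
  ∑ j ∈ J, Matrix.vecMulVec (WithLp.ofLp (b j)) (star (WithLp.ofLp (b j)))

theorem coordMatrix_isStarProjection {𝕜 : Type*} [RCLike 𝕜] {m : ℕ}
    (b : OrthonormalBasis (Fin m) 𝕜 (EuclideanSpace 𝕜 (Fin m))) (J : Finset (Fin m)) :
    IsStarProjection (coordMatrix b J) := by
  have hb : ∀ i j : Fin m,
      star (WithLp.ofLp (b i)) ⬝ᵥ WithLp.ofLp (b j) = if i = j then (1 : 𝕜) else 0 := by
    intro i j
    rw [dotProduct_comm, ← EuclideanSpace.inner_eq_star_dotProduct]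
    exact orthonormal_iff_ite.mp b.orthonormal i j
  refine ⟨?_, ?_⟩
  · unfold IsIdempotentElem coordMatrix
    rw [Finset.sum_mul]
    refine Finset.sum_congr rfl fun i hi => ?_
    rw [Finset.mul_sum, Finset.sum_eq_single i]
    · rw [Matrix.vecMulVec_mul_vecMulVec, hb, if_pos rfl, one_smul]
    · intro j _ hj
      rw [Matrix.vecMulVec_mul_vecMulVec, hb, if_neg hj.symm, zero_smul]
      ext; simp [Matrix.vecMulVec]
    · exact fun h => absurd hi h
  · unfold IsSelfAdjoint coordMatrix
    rw [star_sum]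
    refine Finset.sum_congr rfl fun i _ => ?_
    rw [Matrix.star_eq_conjTranspose, Matrix.conjTranspose_vecMulVec, star_star]

/-- The `J`-coordinate projection with respect to the orthonormal basis `b`. -/
def coordProj {𝕜 : Type*} [RCLike 𝕜] {m : ℕ}
    (b : OrthonormalBasis (Fin m) 𝕜 (EuclideanSpace 𝕜 (Fin m))) (J : Finset (Fin m)) :
    OrthProj 𝕜 m :=
  ⟨coordMatrix b J, coordMatrix_isStarProjection b J⟩

/-- The packing of all coordinate projections onto blocks `J ∈ S` with respect to the bases
`B k`. -/
def coordPacking {𝕜 : Type*} [RCLike 𝕜] {m : ℕ} {K : Type*}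
    (B : K → OrthonormalBasis (Fin m) 𝕜 (EuclideanSpace 𝕜 (Fin m)))
    (S : Finset (Finset (Fin m))) : K × S → OrthProj 𝕜 m :=
  fun p => coordProj (B p.1) p.2.1

/-! ### Block designs -/

/-- `S` is the set of blocks of a `t`-`(m, l, lam)` block design: all blocks have `l` elements,
every `t`-subset of the points lies in exactly `lam` blocks, and every point lies in the same
number of blocks. -/
def IsBlockDesign {m : ℕ} (t l lam : ℕ) (S : Finset (Finset (Fin m))) : Prop :=
  (∀ J ∈ S, J.card = l) ∧
    (∀ T : Finset (Fin m), T.card = t → (S.filter fun J => T ⊆ J).card = lam) ∧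
    ∃ r : ℕ, ∀ x : Fin m, (S.filter fun J => x ∈ J).card = r

/-- Hadamard 3-designs: `3`-`(4 t, 2 t, t - 1)` block designs with `8 t - 2` blocks, `t ≥ 1`.
For `t ≥ 2` the number of blocks follows from the other parameters. For `t = 1` it does not, as
`lam = 0`, and it singles out the set of all 2-subsets of a 4-set, which is the design that comes
from a Hadamard matrix of order 4. -/
def IsHadamardThreeDesign {m : ℕ} (S : Finset (Finset (Fin m))) : Prop :=
  ∃ t : ℕ, 1 ≤ t ∧ m = 4 * t ∧ IsBlockDesign 3 (2 * t) (t - 1) S ∧ S.card = 8 * t - 2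

end OrthoplecticFrames

end

open OrthoplecticFrames

/-!
Projections onto coordinate subspaces of two different unbiased bases have orthogonal traceless
parts, and within one basis the inner product of the embedded vectors of `P_J` and `P_J'` depends
only on `#J`, `#J'` and `#(J ∩ J')`. Hence the embedded vectors form an orthoplex exactly when
`S` is closed under complements, its blocks have `m / 2` points, blocks that are neither equal nor
complementary meet in `m / 4` points, and the count `#S = 2 * (m - 1)` is right. The `± 1` indicator
vectors of the blocks, one from each complementary pair, together with the constant vector are then
the rows of a Hadamard matrix of order `m`, and orthogonality of its columns gives the 3-design
conditions. Conversely, in a Hadamard 3-design with `m = 4 * t` and a block `J`, double counting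
shows that the sum of `#(J ∩ J') * (#(J ∩ J') - t) ^ 2` over all blocks `J'` is equal to its term
`J' = J`, so any other block meets `J` in `0` or `t` points.

Hadamard 3-designs of order `2 ^ n` come from the affine hyperplanes of an `n`-dimensional space
over the field with two elements. Mutually unbiased bases come from families of symmetric bilinear
forms on such a space with nondegenerate differences: a form `β` has a unimodular function `φ` with
`φ (x + y) = φ x * φ y * (-1) ^ β x y`, and Gauss sums of such functions have constant modulus. Over
`ℂ` the trace forms `tr (z x y)` suffice; over `ℝ` the forms must be alternating, and the Kerdock
set on `F × ZMod 2`, with `F` of odd degree, has the right size.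
-/

namespace OrthoplecticFrames

open Finset Module

/-! ### Orthogonal families of halves of a finite set -/

section SignVectors

variable {α : Type*} [DecidableEq α]

/-- The `±1`-valued indicator of a finite set: a row of a sign matrix. -/
def signOf (J : Finset α) (x : α) : ℤ := if x ∈ J then 1 else -1

theorem signOf_mul_self (J : Finset α) (x : α) : signOf J x * signOf J x = 1 := by
  unfold signOf; split_ifs <;> rfl

theorem sum_sum_sq_sum_mul_comm {ι κ R : Type*} [CommSemiring R] (s : Finset ι) (t : Finset κ)
    (f : ι → κ → R) :
    ∑ x ∈ t, ∑ y ∈ t, (∑ i ∈ s, f i x * f i y) ^ 2 =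
      ∑ i ∈ s, ∑ j ∈ s, (∑ x ∈ t, f i x * f j x) ^ 2 := by
  calc ∑ x ∈ t, ∑ y ∈ t, (∑ i ∈ s, f i x * f i y) ^ 2
      = ∑ x ∈ t, ∑ y ∈ t, ∑ i ∈ s, ∑ j ∈ s, (f i x * f j x) * (f i y * f j y) := by
        simp only [sq, sum_mul_sum, mul_mul_mul_comm]
    _ = ∑ i ∈ s, ∑ j ∈ s, ∑ x ∈ t, ∑ y ∈ t, (f i x * f j x) * (f i y * f j y) := by
        simp only [sum_comm (s := t) (t := s)]
    _ = ∑ i ∈ s, ∑ j ∈ s, (∑ x ∈ t, f i x * f j x) ^ 2 := by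
        simp only [sq, sum_mul_sum]

variable [Fintype α]

theorem signOf_compl (J : Finset α) (x : α) : signOf Jᶜ x = -signOf J x := by
  by_cases h : x ∈ J <;> simp [signOf, h]

theorem sum_signOf (J : Finset α) : ∑ x, signOf J x = 2 * #J - Fintype.card α := by
  have indicator (x) : signOf J x = 2 * (if x ∈ J then 1 else 0) - 1 := by
    unfold signOf; split_ifs <;> rfl
  simp only [indicator, sum_sub_distrib, ← mul_sum, sum_boole, filter_univ_mem, sum_const,
    card_univ, nsmul_eq_mul, mul_one]

theorem sum_signOf_mul_signOf (J J' : Finset α) :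
    ∑ x, signOf J x * signOf J' x = Fintype.card α - 2 * #J - 2 * #J' + 4 * #(J ∩ J') := by
  have indicator (x) : signOf J x * signOf J' x = 1 - 2 * (if x ∈ J then 1 else 0)
      - 2 * (if x ∈ J' then 1 else 0) + 4 * (if x ∈ J ∩ J' then 1 else 0) := by
    by_cases h : x ∈ J <;> by_cases h' : x ∈ J' <;> simp [signOf, h, h']
  simp only [indicator, sum_sub_distrib, sum_add_distrib, ← mul_sum, sum_boole, filter_univ_mem,
    sum_const, card_univ, nsmul_eq_mul, mul_one]

theorem sum_eq_zero_of_map_compl_eq_neg {S : Finset (Finset α)} (hS : ∀ J ∈ S, Jᶜ ∈ S)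
    {f : Finset α → ℤ} (hf : ∀ J, f Jᶜ = -f J) : ∑ J ∈ S, f J = 0 := by
  have compl_sum : ∑ J ∈ S, f J = ∑ J ∈ S, -f J :=
    sum_nbij' compl compl hS hS (fun J _ => compl_compl J) (fun J _ => compl_compl J)
      fun J _ => by rw [hf, neg_neg]
  rw [sum_neg_distrib] at compl_sum
  omega

end SignVectors

/-- A complement-closed family of halves of a finite set in which two members that are neither equal
nor complementary have orthogonal sign vectors. Up to the constant row, the sign vectors of such a
family with `2 * card α - 2` members are the rows, with both signs, of a Hadamard matrix. -/
structure IsOrthogonalHalving {α : Type*} [Fintype α] [DecidableEq α] (S : Finset (Finset α)) :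
    Prop where
  compl_mem : ∀ J ∈ S, Jᶜ ∈ S
  two_mul_card : ∀ J ∈ S, 2 * #J = Fintype.card α
  four_mul_card_inter : ∀ J ∈ S, ∀ J' ∈ S, J' ≠ J → J' ≠ Jᶜ → 4 * #(J ∩ J') = Fintype.card α

namespace IsOrthogonalHalving

variable {α : Type*} [Fintype α] [DecidableEq α] {S : Finset (Finset α)}

theorem sum_sq_sum_signOf_mul_signOf [Nonempty α] (hS : IsOrthogonalHalving S) {J : Finset α}
    (hJ : J ∈ S) :
    ∑ J' ∈ S, (∑ x, signOf J x * signOf J' x) ^ 2 = 2 * (Fintype.card α : ℤ) ^ 2 := by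
  have orthogonal : ∀ J' ∈ S, J' ∉ ({J, Jᶜ} : Finset (Finset α)) →
      (∑ x, signOf J x * signOf J' x) ^ 2 = 0 := by
    intro J' hJ' hne
    simp only [mem_insert, mem_singleton, not_or] at hne
    have card_J := hS.two_mul_card J hJ
    have card_J' := hS.two_mul_card J' hJ'
    have card_inter := hS.four_mul_card_inter J hJ J' hJ' hne.1 hne.2
    rw [sum_signOf_mul_signOf, sq_eq_zero_iff]
    omega
  have pair_subset : {J, Jᶜ} ⊆ S := by
    simpa [insert_subset_iff] using ⟨hJ, hS.compl_mem J hJ⟩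
  rw [← sum_subset pair_subset orthogonal, sum_pair compl_ne_self.symm]
  simp only [signOf_compl, mul_neg, sum_neg_distrib, signOf_mul_self, sum_const, card_univ,
    nsmul_eq_mul, mul_one]
  ring

/-- Row orthogonality of the sign matrix passes to its columns because the column Gram matrix
differs from `2 * card α * δ - 2` by a matrix of Hilbert-Schmidt norm zero. -/
theorem sum_signOf_mul_signOf_of_ne (hS : IsOrthogonalHalving S)
    (hcard : #S + 2 = 2 * Fintype.card α) {x y : α} (hxy : x ≠ y) :
    ∑ J ∈ S, signOf J x * signOf J y = -2 := by
  have : Nonempty α := ⟨x⟩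
  set n : ℤ := (Fintype.card α : ℤ) with hn
  have card_S : (#S : ℤ) = 2 * n - 2 := by omega
  set G : α → α → ℤ := fun x y => ∑ J ∈ S, signOf J x * signOf J y with hG
  have sum_G : ∑ x, ∑ y, G x y = 0 := by
    simp only [hG, sum_comm (s := univ) (t := S), ← sum_mul_sum]
    refine sum_eq_zero fun J hJ => ?_
    have row_sum : ∑ x, signOf J x = 0 := by
      rw [sum_signOf]
      have := hS.two_mul_card J hJ
      omega
    rw [row_sum, zero_mul]
  have sum_sq_G : ∑ x, ∑ y, G x y ^ 2 = (2 * n - 2) * (2 * n ^ 2) := by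
    rw [sum_sum_sq_sum_mul_comm, sum_congr rfl fun J hJ => hS.sum_sq_sum_signOf_mul_signOf hJ,
      sum_const, nsmul_eq_mul, card_S]
  have G_self (x) : G x x = 2 * n - 2 := by
    simp only [hG, signOf_mul_self, sum_const, nsmul_eq_mul, mul_one, card_S]
  have deviation_eq_zero : ∑ x, ∑ y, (G x y + 2 - if x = y then 2 * n else 0) ^ 2 = 0 := by
    have expand (x y) : (G x y + 2 - if x = y then 2 * n else 0) ^ 2 =
        G x y ^ 2 + 4 * G x y + 4 - if x = y then 4 * n * G x y + 8 * n - 4 * n ^ 2 else 0 := by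
      split_ifs <;> ring
    simp only [expand, sum_sub_distrib, sum_add_distrib, ← mul_sum, sum_sq_G, sum_G, sum_ite_eq,
      mem_univ, if_true, G_self, sum_const, card_univ, nsmul_eq_mul, ← hn]
    ring
  have entry := (sum_eq_zero_iff_of_nonneg fun _ _ => sq_nonneg _).1
    ((sum_eq_zero_iff_of_nonneg fun _ _ => sum_nonneg fun _ _ => sq_nonneg _).1
      deviation_eq_zero x (mem_univ x)) y (mem_univ y)
  rw [if_neg hxy, sub_zero, sq_eq_zero_iff] at entry
  exact eq_neg_of_add_eq_zero_left entry

theorem two_mul_card_filter_mem (hS : IsOrthogonalHalving S) (x : α) :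
    2 * #{J ∈ S | x ∈ J} = #S := by
  have indicator (J : Finset α) : (2 * if x ∈ J then 1 else 0 : ℤ) = 1 + signOf J x := by
    unfold signOf; split_ifs <;> rfl
  have linear_sum : ∑ J ∈ S, signOf J x = 0 :=
    sum_eq_zero_of_map_compl_eq_neg hS.compl_mem (signOf_compl · x)
  have count := sum_congr (s₁ := S) rfl fun J _ => indicator J
  rw [sum_add_distrib, linear_sum, ← mul_sum, sum_boole, sum_const, nsmul_eq_mul] at count
  omega

theorem four_mul_card_filter_subset (hS : IsOrthogonalHalving S)
    (hcard : #S + 2 = 2 * Fintype.card α) {T : Finset α} (hT : #T = 3) :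
    4 * #{J ∈ S | T ⊆ J} + 4 = Fintype.card α := by
  obtain ⟨x, y, z, hxy, hxz, hyz, rfl⟩ := card_eq_three.1 hT
  have indicator (J : Finset α) : (8 * if {x, y, z} ⊆ J then 1 else 0 : ℤ) =
      1 + signOf J x + signOf J y + signOf J z + signOf J x * signOf J y
        + signOf J x * signOf J z + signOf J y * signOf J z
        + signOf J x * signOf J y * signOf J z := by
    by_cases hx : x ∈ J <;> by_cases hy : y ∈ J <;> by_cases hz : z ∈ J <;>
      simp [signOf, hx, hy, hz, insert_subset_iff]
  have linear_sum (x) : ∑ J ∈ S, signOf J x = 0 :=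
    sum_eq_zero_of_map_compl_eq_neg hS.compl_mem (signOf_compl · x)
  have cubic_sum : ∑ J ∈ S, signOf J x * signOf J y * signOf J z = 0 :=
    sum_eq_zero_of_map_compl_eq_neg hS.compl_mem fun J => by simp only [signOf_compl]; ring
  have count := sum_congr (s₁ := S) rfl fun J _ => indicator J
  simp only [sum_add_distrib, linear_sum, cubic_sum, hS.sum_signOf_mul_signOf_of_ne hcard hxy,
    hS.sum_signOf_mul_signOf_of_ne hcard hxz, hS.sum_signOf_mul_signOf_of_ne hcard hyz, ← mul_sum,
    sum_boole, sum_const, nsmul_eq_mul] at count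
  omega

end IsOrthogonalHalving

/-! ### Hadamard 3-designs are orthogonal halvings -/

section DoubleCounting

variable {α : Type*} [DecidableEq α] {S : Finset (Finset α)}

theorem sum_descFactorial_card_inter {i lam : ℕ}
    (h : ∀ T : Finset α, #T = i → #{J ∈ S | T ⊆ J} = lam) (A : Finset α) :
    ∑ J ∈ S, (#(A ∩ J)).descFactorial i = (#A).descFactorial i * lam := by
  have subsets_inter (J : Finset α) :
      bipartiteBelow (· ⊆ ·) (A.powersetCard i) J = (A ∩ J).powersetCard i := by
    ext T
    simp only [bipartiteBelow, mem_filter, mem_powersetCard, subset_inter_iff]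
    tauto
  have count := sum_card_bipartiteAbove_eq_sum_card_bipartiteBelow
    (s := A.powersetCard i) (t := S) (· ⊆ ·)
  have blocks_above (T) (hT : T ∈ A.powersetCard i) : #(bipartiteAbove (· ⊆ ·) S T) = lam :=
    h T (mem_powersetCard.1 hT).2
  simp only [sum_congr rfl blocks_above, subsets_inter, card_powersetCard, sum_const,
    smul_eq_mul] at count
  simp only [Nat.descFactorial_eq_factorial_mul_choose, ← mul_sum, ← count, mul_assoc]

theorem card_filter_subset_mul_sub [Fintype α] {l lam : ℕ} (hl : ∀ J ∈ S, #J = l)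
    {T : Finset α} (h : ∀ U : Finset α, #U = #T + 1 → #{J ∈ S | U ⊆ J} = lam) :
    #{J ∈ S | T ⊆ J} * (l - #T) = (Fintype.card α - #T) * lam := by
  have blocks_through (x) (hx : x ∈ Tᶜ) : #(bipartiteAbove (· ∈ ·) {J ∈ S | T ⊆ J} x) = lam := by
    rw [← h (insert x T) (card_insert_of_notMem (mem_compl.1 hx)), bipartiteAbove, filter_filter]
    simp only [insert_subset_iff, and_comm]
  have points_on (J) (hJ : J ∈ ({J ∈ S | T ⊆ J} : Finset _)) :
      #(bipartiteBelow (· ∈ ·) Tᶜ J) = l - #T := by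
    rw [mem_filter] at hJ
    have sdiff_eq : bipartiteBelow (· ∈ ·) Tᶜ J = J \ T := by
      ext x; simp [bipartiteBelow, and_comm]
    rw [sdiff_eq, card_sdiff_of_subset hJ.2, hl J hJ.1]
  have count := sum_card_bipartiteAbove_eq_sum_card_bipartiteBelow
    (s := Tᶜ) (t := {J ∈ S | T ⊆ J}) (· ∈ ·)
  rw [sum_congr rfl blocks_through, sum_congr rfl points_on, sum_const, sum_const, card_compl,
    smul_eq_mul, smul_eq_mul] at count
  exact count.symm

end DoubleCounting

theorem eq_compl_of_disjoint_of_card_add_card {α : Type*} [Fintype α] [DecidableEq α]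
    {J J' : Finset α} (hdisj : Disjoint J J') (hcard : #J + #J' = Fintype.card α) : J' = Jᶜ :=
  eq_of_subset_of_card_le (subset_compl_iff_disjoint_left.2 hdisj) (by rw [card_compl]; omega)

section HadamardDesign

variable {t : ℕ} {S : Finset (Finset (Fin (4 * t)))}

theorem card_filter_subset_of_card_eq_one (ht : 1 ≤ t) (hS : IsBlockDesign 3 (2 * t) (t - 1) S)
    (hcard : #S = 8 * t - 2) {T : Finset (Fin (4 * t))} (hT : #T = 1) :
    #{J ∈ S | T ⊆ J} = 4 * t - 1 := by
  obtain ⟨hl, -, r, hr⟩ := hS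
  have on_singleton (U : Finset (Fin (4 * t))) (hU : #U = 1) : #{J ∈ S | U ⊆ J} = r := by
    obtain ⟨x, rfl⟩ := card_eq_one.1 hU
    simpa only [singleton_subset_iff] using hr x
  have count := card_filter_subset_mul_sub (T := ∅) hl on_singleton
  simp only [empty_subset, filter_true, hcard, card_empty, Nat.sub_zero, Fintype.card_fin] at count
  rw [on_singleton T hT]
  refine Nat.eq_of_mul_eq_mul_left (show 0 < 4 * t by omega) (count.symm.trans ?_)
  rw [show 8 * t - 2 = 2 * (4 * t - 1) by omega]
  ring

theorem eq_powersetCard_two_of_card_eq_six {S : Finset (Finset (Fin 4))} (hl : ∀ J ∈ S, #J = 2)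
    (hcard : #S = 6) : S = univ.powersetCard 2 :=
  eq_of_subset_of_card_le (fun J hJ => mem_powersetCard.2 ⟨subset_univ J, hl J hJ⟩)
    (by rw [hcard, card_powersetCard]; decide)

theorem card_filter_subset_of_card_eq_two (ht : 1 ≤ t) (hS : IsBlockDesign 3 (2 * t) (t - 1) S)
    (hcard : #S = 8 * t - 2) {T : Finset (Fin (4 * t))} (hT : #T = 2) :
    #{J ∈ S | T ⊆ J} = 2 * t - 1 := by
  rcases ht.eq_or_lt with rfl | one_lt
  · have only_T : {J ∈ S | T ⊆ J} = {T} := by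
      ext J
      rw [eq_powersetCard_two_of_card_eq_six hS.1 hcard, mem_filter, mem_powersetCard_univ,
        mem_singleton]
      refine ⟨fun ⟨_, hTJ⟩ => (eq_of_subset_of_card_le hTJ (by omega)).symm, ?_⟩
      rintro rfl
      exact ⟨hT, subset_rfl⟩
    rw [only_T, card_singleton]
  · have count := card_filter_subset_mul_sub (T := T) hS.1 (by rw [hT]; exact hS.2.1)
    rw [hT, Fintype.card_fin, show 4 * t - 2 = 2 * (2 * t - 1) by omega,
      show 2 * t - 2 = 2 * (t - 1) by omega] at count
    refine Nat.eq_of_mul_eq_mul_right (show 0 < 2 * (t - 1) by omega) (count.trans ?_)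
    ring

theorem sum_card_inter (ht : 1 ≤ t) (hS : IsBlockDesign 3 (2 * t) (t - 1) S)
    (hcard : #S = 8 * t - 2) {J : Finset (Fin (4 * t))} (hJ : J ∈ S) :
    ∑ J' ∈ S, (#(J ∩ J') : ℤ) = 2 * t * (4 * t - 1) := by
  have count := sum_descFactorial_card_inter
    (fun T hT => card_filter_subset_of_card_eq_one ht hS hcard hT) J
  simp only [Nat.descFactorial_one, hS.1 J hJ] at count
  zify [show 1 ≤ 4 * t by omega] at count
  exact count

theorem sum_card_inter_mul_sq_sub (ht : 1 ≤ t) (hS : IsBlockDesign 3 (2 * t) (t - 1) S)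
    (hcard : #S = 8 * t - 2) {J : Finset (Fin (4 * t))} (hJ : J ∈ S) :
    ∑ J' ∈ S, (#(J ∩ J') : ℤ) * (#(J ∩ J') - t) ^ 2 = 2 * t * t ^ 2 := by
  have cast_two (n : ℕ) : (n.descFactorial 2 : ℤ) = n * (n - 1) := by
    rw [← descPochhammer_eval_eq_descFactorial]; simp [descPochhammer_succ_eval]
  have cast_three (n : ℕ) : (n.descFactorial 3 : ℤ) = n * (n - 1) * (n - 2) := by
    rw [← descPochhammer_eval_eq_descFactorial]; simp [descPochhammer_succ_eval]
  have expand (n : ℕ) : (n : ℤ) * (n - t) ^ 2 =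
      n.descFactorial 3 + (3 - 2 * t) * n.descFactorial 2 + (t - 1) ^ 2 * n := by
    rw [cast_two, cast_three]; ring
  have pairs := sum_descFactorial_card_inter
    (fun T hT => card_filter_subset_of_card_eq_two ht hS hcard hT) J
  have triples := sum_descFactorial_card_inter hS.2.1 J
  rw [hS.1 J hJ] at pairs triples
  zify [show 1 ≤ 2 * t by omega, ht] at pairs triples
  simp only [expand, sum_add_distrib, ← mul_sum, pairs, triples, sum_card_inter ht hS hcard hJ]
  rw [cast_two, cast_three]
  push_cast
  ring

theorem card_inter_eq_zero_or_eq (ht : 1 ≤ t) (hS : IsBlockDesign 3 (2 * t) (t - 1) S)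
    (hcard : #S = 8 * t - 2) {J J' : Finset (Fin (4 * t))} (hJ : J ∈ S) (hJ' : J' ∈ S)
    (hne : J' ≠ J) : #(J ∩ J') = 0 ∨ #(J ∩ J') = t := by
  have moment := sum_card_inter_mul_sq_sub ht hS hcard hJ
  rw [← add_sum_erase S _ hJ, inter_self, hS.1 J hJ] at moment
  have others : ∑ J' ∈ S.erase J, (#(J ∩ J') : ℤ) * (#(J ∩ J') - t) ^ 2 = 0 := by
    push_cast at moment; linear_combination moment
  have term := (sum_eq_zero_iff_of_nonneg fun _ _ =>
    mul_nonneg (Int.natCast_nonneg _) (sq_nonneg _)).1 others J' (mem_erase.2 ⟨hne, hJ'⟩)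
  simpa [sub_eq_zero] using term

theorem eq_compl_of_card_inter_eq_zero (hS : IsBlockDesign 3 (2 * t) (t - 1) S)
    {J J' : Finset (Fin (4 * t))} (hJ : J ∈ S) (hJ' : J' ∈ S) (h : #(J ∩ J') = 0) : J' = Jᶜ := by
  refine eq_compl_of_disjoint_of_card_add_card ?_ ?_
  · rwa [disjoint_iff_inter_eq_empty, ← card_eq_zero]
  · rw [hS.1 J hJ, hS.1 J' hJ', Fintype.card_fin]
    omega

theorem compl_mem_of_isBlockDesign (ht : 1 ≤ t) (hS : IsBlockDesign 3 (2 * t) (t - 1) S)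
    (hcard : #S = 8 * t - 2) {J : Finset (Fin (4 * t))} (hJ : J ∈ S) : Jᶜ ∈ S := by
  by_contra compl_notMem
  have inter_eq (J') (hJ' : J' ∈ S.erase J) : (#(J ∩ J') : ℤ) = t := by
    obtain ⟨hne, hJ'⟩ := mem_erase.1 hJ'
    rcases card_inter_eq_zero_or_eq ht hS hcard hJ hJ' hne with h | h
    · exact absurd (eq_compl_of_card_inter_eq_zero hS hJ hJ' h ▸ hJ') compl_notMem
    · rw [h]
  have total := sum_card_inter ht hS hcard hJ
  rw [← add_sum_erase S _ hJ, inter_self, hS.1 J hJ, sum_congr rfl inter_eq, sum_const,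
    card_erase_of_mem hJ, hcard, nsmul_eq_mul] at total
  zify [show 1 ≤ 8 * t - 2 by omega, show 2 ≤ 8 * t by omega] at total
  have : (t : ℤ) = 0 := by linear_combination total
  omega

theorem isOrthogonalHalving_of_isBlockDesign (ht : 1 ≤ t)
    (hS : IsBlockDesign 3 (2 * t) (t - 1) S) (hcard : #S = 8 * t - 2) : IsOrthogonalHalving S where
  compl_mem _ hJ := compl_mem_of_isBlockDesign ht hS hcard hJ
  two_mul_card J hJ := by
    rw [hS.1 J hJ, Fintype.card_fin]
    omega
  four_mul_card_inter J hJ J' hJ' hne hne_compl := by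
    rcases card_inter_eq_zero_or_eq ht hS hcard hJ hJ' hne with h | h
    · exact absurd (eq_compl_of_card_inter_eq_zero hS hJ hJ' h) hne_compl
    · rw [h, Fintype.card_fin]

end HadamardDesign

theorem IsOrthogonalHalving.isHadamardThreeDesign {m : ℕ} {S : Finset (Finset (Fin m))}
    (hS : IsOrthogonalHalving S) (hm : 2 < m) (hcard : #S + 2 = 2 * m) :
    IsHadamardThreeDesign S := by
  obtain ⟨J, hJ⟩ : S.Nonempty := card_pos.1 (by omega)
  obtain ⟨J', hJ', hne⟩ : ∃ J' ∈ S, J' ∉ ({J, Jᶜ} : Finset _) :=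
    exists_mem_notMem_of_card_lt_card (card_le_two.trans_lt (by omega))
  simp only [mem_insert, mem_singleton, not_or] at hne
  have m_eq := hS.four_mul_card_inter J hJ J' hJ' hne.1 hne.2
  set t := #(J ∩ J')
  rw [Fintype.card_fin] at m_eq
  refine ⟨t, by omega, by omega, ⟨fun J hJ => ?_, fun T hT => ?_, 4 * t - 1, fun x => ?_⟩, by omega⟩
  · have := hS.two_mul_card J hJ
    rw [Fintype.card_fin] at this
    omega
  · have := hS.four_mul_card_filter_subset (by rwa [Fintype.card_fin]) hT
    rw [Fintype.card_fin] at this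
    omega
  · have := hS.two_mul_card_filter_mem x
    omega

theorem isHadamardThreeDesign_iff {m : ℕ} {S : Finset (Finset (Fin m))} :
    IsHadamardThreeDesign S ↔ 2 < m ∧ IsOrthogonalHalving S ∧ #S + 2 = 2 * m := by
  refine ⟨?_, fun ⟨hm, hS, hcard⟩ => hS.isHadamardThreeDesign hm hcard⟩
  rintro ⟨t, ht, rfl, hS, hcard⟩
  exact ⟨by omega, isOrthogonalHalving_of_isBlockDesign ht hS hcard, by omega⟩

/-! ### The space of trace-zero Hermitian matrices -/

/-- The sum of the coordinates of a real vector, as a linear functional. -/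
def coordSum (ι : Type*) [Fintype ι] : (ι → ℝ) →ₗ[ℝ] ℝ := ∑ i, LinearMap.proj i

theorem coordSum_apply {ι : Type*} [Fintype ι] (v : ι → ℝ) : coordSum ι v = ∑ i, v i := by
  simp [coordSum]

theorem finrank_ker_coordSum_add_one (ι : Type*) [Fintype ι] [Nonempty ι] :
    finrank ℝ (LinearMap.ker (coordSum ι)) + 1 = Fintype.card ι := by
  have coordSum_ne_zero : coordSum ι ≠ 0 := fun h => by
    have := DFunLike.congr_fun h 1
    simp [coordSum_apply] at this
  rw [Module.Dual.finrank_ker_add_one_of_ne_zero coordSum_ne_zero, finrank_fintype_fun_eq_card]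

theorem two_mul_card_subtype_fst_lt_snd (m : ℕ) :
    2 * Fintype.card {p : Fin m × Fin m // p.1 < p.2} = m * (m - 1) := by
  have card_eq_sum : Fintype.card {p : Fin m × Fin m // p.1 < p.2} = ∑ j : Fin m, (j : ℕ) := by
    rw [Fintype.card_subtype, card_filter, Fintype.sum_prod_type_right]
    simp only [← card_filter, filter_gt_eq_Iio, Fin.card_Iio]
  rw [card_eq_sum, Fin.sum_univ_eq_sum_range (fun i => i), mul_comm, sum_range_id_mul_two]

section TracelessHermitian

variable (𝕜 : Type*) [RCLike 𝕜] (m : ℕ)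

theorem finrank_real_eq_one_or_two : finrank ℝ 𝕜 = 1 ∨ finrank ℝ 𝕜 = 2 := by
  have le_two := RCLike.finrank_le_two (K := 𝕜)
  have pos : 0 < finrank ℝ 𝕜 := finrank_pos
  omega

/-- The coordinates of a trace-zero Hermitian matrix: its entries above the diagonal and the real
vector of its diagonal entries. -/
def upperEntries : tracelessHermitian 𝕜 m →ₗ[ℝ]
    ({p : Fin m × Fin m // p.1 < p.2} → 𝕜) × LinearMap.ker (coordSum (Fin m)) where
  toFun A := (fun p => A.1 p.1.1 p.1.2, ⟨fun i => RCLike.re (A.1 i i), by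
    have re_trace := congrArg RCLike.re A.2.2
    rwa [Matrix.trace, map_sum, map_zero, ← coordSum_apply] at re_trace⟩)
  map_add' A B := by ext <;> simp
  map_smul' c A := by ext <;> simp [RCLike.smul_re]

theorem upperEntries_injective : Function.Injective (upperEntries 𝕜 m) := by
  rw [injective_iff_map_eq_zero]
  intro A hA
  have upper (i j : Fin m) (hij : i < j) : A.1 i j = 0 :=
    congrFun (congrArg Prod.fst hA) ⟨(i, j), hij⟩
  have diag (i : Fin m) : RCLike.re (A.1 i i) = 0 :=
    congrFun (congrArg Subtype.val (congrArg Prod.snd hA)) i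
  ext i j
  change A.1 i j = 0
  rcases lt_trichotomy i j with hij | rfl | hji
  · exact upper i j hij
  · rw [← A.2.1.coe_re_apply_self i, diag, RCLike.ofReal_zero]
  · rw [← A.2.1.apply i j, upper j i hji, star_zero]

theorem upperEntries_surjective : Function.Surjective (upperEntries 𝕜 m) := by
  rintro ⟨u, d, hd⟩
  refine ⟨⟨Matrix.of fun i j => if h : i < j then u ⟨(i, j), h⟩ else
    if h : j < i then star (u ⟨(j, i), h⟩) else (d i : 𝕜), ?_, ?_⟩, ?_⟩
  · ext i j
    rw [Matrix.conjTranspose_apply]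
    rcases lt_trichotomy i j with hij | rfl | hji
    · simp [hij, hij.not_gt]
    · simp
    · simp [hji, hji.not_gt]
  · rw [LinearMap.mem_ker, coordSum_apply] at hd
    simp only [Matrix.trace, Matrix.diag_apply, Matrix.of_apply, lt_irrefl, dite_false]
    rw [← RCLike.ofReal_sum, hd, RCLike.ofReal_zero]
  · ext p
    · simp [upperEntries, p.2]
    · simp [upperEntries]

theorem finrank_tracelessHermitian [NeZero m] :
    finrank ℝ (tracelessHermitian 𝕜 m) = embDim 𝕜 m := by
  have card_pairs := two_mul_card_subtype_fst_lt_snd m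
  have finrank_diag := finrank_ker_coordSum_add_one (Fin m)
  rw [Fintype.card_fin] at finrank_diag
  rw [(LinearEquiv.ofBijective _ ⟨upperEntries_injective 𝕜 m,
    upperEntries_surjective 𝕜 m⟩).finrank_eq, finrank_prod, finrank_pi_fintype, sum_const,
    smul_eq_mul, card_univ, embDim]
  obtain ⟨n, rfl⟩ := Nat.exists_eq_add_one_of_ne_zero (NeZero.ne m)
  rw [Nat.add_sub_cancel] at card_pairs
  rcases finrank_real_eq_one_or_two 𝕜 with h | h
  · rw [if_pos h, h, show (n + 1) * (n + 1 + 1) = (n + 1) * n + 2 * (n + 1) by ring]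
    omega
  · rw [if_neg (by omega), h, show (n + 1) ^ 2 = (n + 1) * n + (n + 1) by ring]
    omega

/-- The Hilbert-Schmidt inner product `tr (A B)` on the trace-zero Hermitian matrices. -/
@[reducible]
def hilbertSchmidtCore : InnerProductSpace.Core ℝ (tracelessHermitian 𝕜 m) where
  inner A B := RCLike.re (A.1 * B.1).trace
  conj_inner_symm A B := by rw [Matrix.trace_mul_comm]; rfl
  re_inner_nonneg A := by
    have trace_nonneg := (Matrix.posSemidef_conjTranspose_mul_self A.1).trace_nonneg
    rw [A.2.1.eq] at trace_nonneg
    exact (RCLike.nonneg_iff.1 trace_nonneg).1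
  add_left A B C := by simp [add_mul]
  smul_left A B c := by simp [RCLike.smul_re]
  definite A hA := by
    have trace_nonneg := (Matrix.posSemidef_conjTranspose_mul_self A.1).trace_nonneg
    have trace_eq_zero : (A.1.conjTranspose * A.1).trace = 0 := by
      rw [A.2.1.eq] at trace_nonneg ⊢
      exact RCLike.ext (by simpa using hA) (by simpa using (RCLike.nonneg_iff.1 trace_nonneg).2)
    exact Subtype.ext (Matrix.trace_conjTranspose_mul_self_eq_zero_iff.1 trace_eq_zero)

theorem exists_isHilbertSchmidtIsometry [NeZero m] :
    ∃ V : tracelessHermitian 𝕜 m ≃ₗ[ℝ] EuclideanSpace ℝ (Fin (embDim 𝕜 m)),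
      IsHilbertSchmidtIsometry V := by
  let _ : NormedAddCommGroup (tracelessHermitian 𝕜 m) :=
    (hilbertSchmidtCore 𝕜 m).toNormedAddCommGroup
  let _ : InnerProductSpace ℝ (tracelessHermitian 𝕜 m) :=
    InnerProductSpace.ofCore (hilbertSchmidtCore 𝕜 m).toCore
  let b := (stdOrthonormalBasis ℝ (tracelessHermitian 𝕜 m)).reindex
    (finCongr (finrank_tracelessHermitian 𝕜 m))
  exact ⟨b.repr.toLinearEquiv, fun A B => b.repr.inner_map_map A B⟩

end TracelessHermitian

/-! ### Coordinate projections and their embedded vectors -/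

section CoordinateProjections

variable {𝕜 : Type*} [RCLike 𝕜] {m : ℕ}
  (b b' : OrthonormalBasis (Fin m) 𝕜 (EuclideanSpace 𝕜 (Fin m)))

theorem re_trace_coordMatrix_mul (J J' : Finset (Fin m)) :
    RCLike.re (coordMatrix b J * coordMatrix b' J').trace =
      ∑ i ∈ J, ∑ j ∈ J', ‖inner 𝕜 (b i) (b' j)‖ ^ 2 := by
  simp only [coordMatrix, sum_mul, mul_sum, Matrix.trace_sum, map_sum]
  rw [sum_comm]
  refine sum_congr rfl fun i _ => sum_congr rfl fun j _ => ?_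
  rw [Matrix.vecMulVec_mul_vecMulVec, Matrix.trace_vecMulVec, dotProduct_smul, smul_eq_mul,
    dotProduct_comm (star _) (WithLp.ofLp (b' j)), ← EuclideanSpace.inner_eq_star_dotProduct,
    ← EuclideanSpace.inner_eq_star_dotProduct, ← inner_conj_symm (b' j) (b i), RCLike.mul_conj]
  norm_cast

theorem re_trace_coordMatrix_mul_self_basis (J J' : Finset (Fin m)) :
    RCLike.re (coordMatrix b J * coordMatrix b J').trace = #(J ∩ J') := by
  have norm_sq (i j) : ‖inner 𝕜 (b i) (b j)‖ ^ 2 = if i = j then (1 : ℝ) else 0 := by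
    rw [orthonormal_iff_ite.mp b.orthonormal i j]; split_ifs <;> simp
  simp [re_trace_coordMatrix_mul, norm_sq]

theorem rank_coordProj (J : Finset (Fin m)) : (coordProj b J).1.rank = #J := by
  have trace_eq := congrArg RCLike.re (trace_eq_rank (coordProj b J))
  have trace_sq := re_trace_coordMatrix_mul_self_basis b J J
  rw [(coordMatrix_isStarProjection b J).isIdempotentElem.eq, inter_self] at trace_sq
  rw [RCLike.natCast_re] at trace_eq
  exact_mod_cast trace_eq.symm.trans trace_sq

theorem coordMatrix_univ : coordMatrix b univ = 1 := by
  refine Matrix.mulVec_injective (funext fun v => ?_)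
  have expansion := congrArg WithLp.ofLp (b.sum_repr' (WithLp.toLp 2 v))
  simp only [WithLp.ofLp_sum, WithLp.ofLp_smul,
    EuclideanSpace.inner_eq_star_dotProduct] at expansion
  simp only [coordMatrix, Matrix.sum_mulVec, Matrix.vecMulVec_mulVec, Matrix.one_mulVec,
    dotProduct_comm (star _), op_smul_eq_smul, expansion]

theorem coordMatrix_compl (J : Finset (Fin m)) : coordMatrix b Jᶜ = 1 - coordMatrix b J := by
  rw [← coordMatrix_univ b, eq_sub_iff_add_eq', coordMatrix, coordMatrix, sum_add_sum_compl,
    coordMatrix]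

theorem sum_coordMatrix {r : ℕ} {S : Finset (Finset (Fin m))}
    (hr : ∀ x, #{J ∈ S | x ∈ J} = r) : ∑ J ∈ S, coordMatrix b J = (r : Matrix _ _ 𝕜) := by
  rw [← mul_one (r : Matrix (Fin m) (Fin m) 𝕜), ← coordMatrix_univ b]
  unfold coordMatrix
  rw [mul_sum, sum_comm' (t' := univ) (s' := fun x => {J ∈ S | x ∈ J}) (by simp [and_comm])]
  refine sum_congr rfl fun x _ => ?_
  rw [sum_const, hr, nsmul_eq_mul]

end CoordinateProjections

section EmbeddedVectors

variable {𝕜 : Type*} [RCLike 𝕜] {m d l : ℕ} [NeZero m]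
  {V : tracelessHermitian 𝕜 m ≃ₗ[ℝ] EuclideanSpace ℝ (Fin d)}

theorem inner_tracelessMap (hV : IsHilbertSchmidtIsometry V) (P Q : OrthProj 𝕜 m) :
    inner ℝ (V (tracelessMap P)) (V (tracelessMap Q)) =
      RCLike.re (P.1 * Q.1).trace - (P.1.rank : ℝ) * Q.1.rank / m := by
  have m_ne_zero : (m : ℝ) ≠ 0 := NeZero.ne _
  rw [hV]
  simp only [tracelessMap, sub_mul, mul_sub, Matrix.trace_sub, Matrix.mul_smul, Matrix.smul_mul,
    Matrix.mul_one, Matrix.one_mul, Matrix.trace_smul, trace_eq_rank, Matrix.trace_one, map_sub,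
    RCLike.smul_re, RCLike.natCast_re, Fintype.card_fin]
  field_simp
  ring

theorem inner_embeddedVector (hV : IsHilbertSchmidtIsometry V) (P Q : OrthProj 𝕜 m)
    (hP : P.1.rank = l) (hQ : Q.1.rank = l) :
    inner ℝ (embeddedVector V P) (embeddedVector V Q) =
      (RCLike.re (P.1 * Q.1).trace - (l : ℝ) ^ 2 / m) / (l * (m - l) / m) := by
  have l_le_m : (l : ℝ) ≤ m := by
    rw [← hP]
    exact_mod_cast P.1.rank_le_width
  have norm_sq_nonneg : 0 ≤ (l : ℝ) * (m - l) / m :=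
    div_nonneg (mul_nonneg l.cast_nonneg (sub_nonneg.2 l_le_m)) m.cast_nonneg
  unfold embeddedVector
  rw [real_inner_smul_left, real_inner_smul_right, inner_tracelessMap hV, hP, hQ, ← mul_assoc,
    ← mul_inv, Real.mul_self_sqrt norm_sq_nonneg, inv_mul_eq_div, pow_two]

theorem inner_embeddedVector_coordProj (hV : IsHilbertSchmidtIsometry V)
    (b : OrthonormalBasis (Fin m) 𝕜 (EuclideanSpace 𝕜 (Fin m))) {J J' : Finset (Fin m)}
    (hJ : #J = l) (hJ' : #J' = l) :
    inner ℝ (embeddedVector V (coordProj b J)) (embeddedVector V (coordProj b J')) =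
      (#(J ∩ J') - (l : ℝ) ^ 2 / m) / (l * (m - l) / m) := by
  rw [inner_embeddedVector hV _ _ ((rank_coordProj b J).trans hJ)
    ((rank_coordProj b J').trans hJ')]
  simp only [coordProj, re_trace_coordMatrix_mul_self_basis]

theorem inner_embeddedVector_coordProj_of_ne (hV : IsHilbertSchmidtIsometry V) {K : Type*}
    {B : K → OrthonormalBasis (Fin m) 𝕜 (EuclideanSpace 𝕜 (Fin m))} (hB : IsMUB B)
    {k k' : K} (hk : k ≠ k') {J J' : Finset (Fin m)} (hJ : #J = l) (hJ' : #J' = l) :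
    inner ℝ (embeddedVector V (coordProj (B k) J)) (embeddedVector V (coordProj (B k') J')) =
      0 := by
  rw [inner_embeddedVector hV _ _ ((rank_coordProj _ J).trans hJ)
    ((rank_coordProj _ J').trans hJ')]
  simp only [coordProj, re_trace_coordMatrix_mul, hB k k' hk, sum_const, hJ, hJ', nsmul_eq_mul]
  rw [show (l : ℝ) * (l * (1 / m)) - (l : ℝ) ^ 2 / m = 0 by ring, zero_div]

theorem embeddedVector_coordProj_compl
    (V : tracelessHermitian 𝕜 m ≃ₗ[ℝ] EuclideanSpace ℝ (Fin d))
    (b : OrthonormalBasis (Fin m) 𝕜 (EuclideanSpace 𝕜 (Fin m))) (J : Finset (Fin m)) :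
    embeddedVector V (coordProj b Jᶜ) = -embeddedVector V (coordProj b J) := by
  have m_ne_zero : (m : ℝ) ≠ 0 := NeZero.ne _
  have card_compl : (#Jᶜ : ℝ) = m - #J := by
    rw [card_compl, Fintype.card_fin,
      Nat.cast_sub ((card_le_univ J).trans_eq (Fintype.card_fin m))]
  have traceless_compl : tracelessMap (coordProj b Jᶜ) = -tracelessMap (coordProj b J) := by
    ext1
    simp only [tracelessMap, rank_coordProj, card_compl, NegMemClass.coe_neg]
    simp only [coordProj, coordMatrix_compl, sub_div, div_self m_ne_zero, sub_smul, one_smul]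
    abel
  rw [embeddedVector, embeddedVector, traceless_compl, map_neg, smul_neg, rank_coordProj,
    rank_coordProj, card_compl, sub_sub_cancel, mul_comm]

theorem inner_embeddedVector_coordProj_of_two_mul_card (hV : IsHilbertSchmidtIsometry V)
    (b : OrthonormalBasis (Fin m) 𝕜 (EuclideanSpace 𝕜 (Fin m))) {J J' : Finset (Fin m)}
    (hJ : 2 * #J = m) (hJ' : 2 * #J' = m) :
    inner ℝ (embeddedVector V (coordProj b J)) (embeddedVector V (coordProj b J')) =
      4 * (#(J ∩ J') : ℝ) / m - 1 := by
  have card_eq : (#J : ℝ) = m / 2 := by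
    rw [eq_div_iff two_ne_zero, mul_comm]; exact_mod_cast hJ
  have m_ne_zero : (m : ℝ) ≠ 0 := NeZero.ne _
  rw [inner_embeddedVector_coordProj hV b rfl (by omega), card_eq]
  field_simp
  ring

end EmbeddedVectors

/-! ### Orthoplexes -/

section Orthoplex

variable {d : ℕ} {ι : Type*} {v : ι → EuclideanSpace ℝ (Fin d)}

theorem exists_orthonormalBasis_coe_eq {𝕜 E I : Type*} [RCLike 𝕜] [NormedAddCommGroup E]
    [InnerProductSpace 𝕜 E] [FiniteDimensional 𝕜 E] [Fintype I] {w : I → E} (hw : Orthonormal 𝕜 w)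
    (hcard : Fintype.card I = finrank 𝕜 E) : ∃ e : OrthonormalBasis I 𝕜 E, ⇑e = w :=
  ⟨OrthonormalBasis.mk hw (hw.linearIndependent.span_eq_top_of_card_eq_finrank' hcard).ge,
    OrthonormalBasis.coe_mk _ _⟩

theorem formsOrthoplex_of_orthonormal {I : Type*} [Fintype I] {w : I → EuclideanSpace ℝ (Fin d)}
    (hw : Orthonormal ℝ w) (hcard : Fintype.card I = d)
    (hv : Set.range v = Set.range w ∪ Set.range (-w)) : FormsOrthoplex v := by
  obtain ⟨e, e_eq⟩ := exists_orthonormalBasis_coe_eq hw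
    (by rw [hcard, finrank_euclideanSpace_fin])
  let σ := Fintype.equivFinOfCardEq hcard
  refine ⟨e.reindex σ, ?_⟩
  have neg_range : Set.range (fun j => -(e.reindex σ) j) = Set.range (-w) := by
    rw [← σ.symm.surjective.range_comp (-w)]
    simp only [OrthonormalBasis.reindex_apply, e_eq]
    rfl
  rw [hv, neg_range, OrthonormalBasis.coe_reindex, e_eq, σ.symm.surjective.range_comp w]

namespace FormsOrthoplex

theorem exists_basis_eq_or_eq_neg (hv : FormsOrthoplex v) :
    ∃ e : OrthonormalBasis (Fin d) ℝ (EuclideanSpace ℝ (Fin d)),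
      ∀ i, ∃ j, v i = e j ∨ v i = -e j := by
  obtain ⟨e, he⟩ := hv
  refine ⟨e, fun i => ?_⟩
  rcases he ▸ Set.mem_range_self i with ⟨j, hj⟩ | ⟨j, hj⟩
  exacts [⟨j, .inl hj.symm⟩, ⟨j, .inr hj.symm⟩]

theorem inner_self_eq_one (hv : FormsOrthoplex v) (i : ι) : inner ℝ (v i) (v i) = 1 := by
  obtain ⟨e, he⟩ := hv.exists_basis_eq_or_eq_neg
  obtain ⟨j, hj | hj⟩ := he i <;> simp [hj]

theorem exists_eq_neg (hv : FormsOrthoplex v) (i : ι) : ∃ i', v i' = -v i := by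
  obtain ⟨e, he⟩ := hv
  suffices -v i ∈ Set.range v from this
  rw [he]
  rcases he ▸ Set.mem_range_self i with ⟨j, hj⟩ | ⟨j, hj⟩
  · exact .inr ⟨j, congrArg _ hj⟩
  · exact .inl ⟨j, by rw [← hj, neg_neg]⟩

theorem inner_eq_one_or_neg_one_or_zero (hv : FormsOrthoplex v) (i i' : ι) :
    inner ℝ (v i) (v i') = 1 ∨ inner ℝ (v i) (v i') = -1 ∨ inner ℝ (v i) (v i') = 0 := by
  obtain ⟨e, he⟩ := hv.exists_basis_eq_or_eq_neg
  obtain ⟨j, hj⟩ := he i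
  obtain ⟨j', hj'⟩ := he i'
  rcases eq_or_ne j j' with rfl | hne
  · rcases hj with hj | hj <;> rcases hj' with hj' | hj' <;> simp [hj, hj']
  · have orthogonal : inner ℝ (e j) (e j') = 0 := e.orthonormal.2 hne
    rcases hj with hj | hj <;> rcases hj' with hj' | hj' <;> simp [hj, hj', orthogonal]

end FormsOrthoplex

end Orthoplex

/-! ### Orthoplectic coordinate packings -/

section MaximalMUB

variable {𝕜 : Type*} [RCLike 𝕜] {m : ℕ} {K : Type*} [Fintype K]

theorem nonempty_of_card_eq_maxMUB (hK : (Fintype.card K : ℚ) = maxMUB 𝕜 m) : Nonempty K := by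
  have maxMUB_pos : 0 < maxMUB 𝕜 m := by unfold maxMUB; split_ifs <;> positivity
  rw [← Fintype.card_pos_iff]
  exact_mod_cast hK ▸ maxMUB_pos

theorem two_mul_embDim_eq_card_mul [NeZero m] (hK : (Fintype.card K : ℚ) = maxMUB 𝕜 m) :
    2 * embDim 𝕜 m = Fintype.card K * (2 * m - 2) := by
  obtain ⟨n, rfl⟩ := Nat.exists_eq_succ_of_ne_zero (NeZero.ne m)
  rw [show 2 * n.succ - 2 = 2 * n by omega, embDim]
  rw [maxMUB] at hK
  split_ifs at hK ⊢
  · have two_mul_card : 2 * Fintype.card K = n + 3 := by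
      have : 2 * (Fintype.card K : ℚ) = n + 3 := by rw [hK]; push_cast; ring
      exact_mod_cast this
    have even_prod : 2 ∣ n.succ * (n.succ + 1) := (Nat.even_mul_succ_self _).two_dvd
    rw [Nat.mul_sub, Nat.mul_div_cancel' even_prod, mul_left_comm, ← mul_assoc, two_mul_card,
      Nat.sub_eq_iff_eq_add (by nlinarith), Nat.succ_eq_add_one]
    ring
  · have card_eq : Fintype.card K = n + 2 := by
      have : (Fintype.card K : ℚ) = n + 2 := by rw [hK]; push_cast; ring
      exact_mod_cast this
    rw [card_eq, show n.succ ^ 2 = (n + 2) * n + 1 by rw [Nat.succ_eq_add_one]; ring,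
      Nat.add_sub_cancel]
    ring

end MaximalMUB

section CoordinatePackings

variable {𝕜 : Type*} [RCLike 𝕜] {m : ℕ} {S : Finset (Finset (Fin m))} {K : Type*}
  {B : K → OrthonormalBasis (Fin m) 𝕜 (EuclideanSpace 𝕜 (Fin m))}

theorem isConstantRank_coordPacking [Fintype K] [Nonempty K] {l : ℕ} (hl : ∀ J ∈ S, #J = l)
    (hS : S.Nonempty) : IsConstantRank (coordPacking B S) := by
  have : Nonempty S := hS.to_subtype
  have rank_eq : (fun i => (coordPacking B S i).1.rank) = fun _ => l :=
    funext fun i => (rank_coordProj _ _).trans (hl _ i.2.2)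
  rw [IsConstantRank, mixture, rank_eq, image_const univ_nonempty, card_singleton]

theorem isFusionFrame_coordPacking [Fintype K] [Nonempty K] {r : ℕ}
    (hr : ∀ x, #{J ∈ S | x ∈ J} = r) (r_pos : 0 < r) : IsFusionFrame (coordPacking B S) := by
  have frame_operator : ∑ i, (coordPacking B S i).1 =
      ((Fintype.card K * r : ℕ) : Matrix (Fin m) (Fin m) 𝕜) := by
    have sum_blocks (k : K) : ∑ J : S, (coordPacking B S (k, J)).1 = (r : Matrix _ _ 𝕜) :=
      (sum_coe_sort S (coordMatrix (B k))).trans (sum_coordMatrix (B k) hr)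
    simp only [Fintype.sum_prod_type, sum_blocks, sum_const, card_univ, nsmul_eq_mul, Nat.cast_mul]
  rw [IsFusionFrame, frame_operator]
  exact Matrix.PosDef.natCast _ (Nat.mul_pos Fintype.card_pos r_pos).ne'

variable [NeZero m] {d l : ℕ} {V : tracelessHermitian 𝕜 m ≃ₗ[ℝ] EuclideanSpace ℝ (Fin d)}

theorem orthonormal_embeddedVector_coordProj (hS : IsOrthogonalHalving S)
    (hV : IsHilbertSchmidtIsometry V) (hB : IsMUB B) (x : Fin m) :
    Orthonormal ℝ fun i : K × {J ∈ S | x ∈ J} =>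
      embeddedVector V (coordProj (B i.1) i.2.1) := by
  classical
  have two_mul_card (J) (hJ : J ∈ S) : 2 * #J = m :=
    (hS.two_mul_card J hJ).trans (Fintype.card_fin m)
  have m_ne_zero : (m : ℝ) ≠ 0 := NeZero.ne _
  rw [orthonormal_iff_ite]
  rintro ⟨k, J, hJ⟩ ⟨k', J', hJ'⟩
  rw [mem_filter] at hJ hJ'
  obtain rfl | hk := eq_or_ne k k'
  · rw [inner_embeddedVector_coordProj_of_two_mul_card hV _ (two_mul_card J hJ.1)
      (two_mul_card J' hJ'.1)]
    split_ifs with h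
    · obtain rfl : J = J' := by simpa using h
      have card_cast : 2 * (#J : ℝ) = m := by exact_mod_cast two_mul_card J hJ.1
      rw [inter_self]
      field_simp
      linarith
    · have ne_block : J' ≠ J := fun h' => h (by simp [h'])
      have ne_compl : J' ≠ Jᶜ := fun h' => mem_compl.1 (h' ▸ hJ'.2) hJ.2
      have four_mul : (4 * #(J ∩ J') : ℝ) = m := by
        exact_mod_cast (hS.four_mul_card_inter J hJ.1 J' hJ'.1 ne_block ne_compl).trans
          (Fintype.card_fin m)
      rw [four_mul, div_self m_ne_zero, sub_self]
  · rw [if_neg fun h => hk (congrArg Prod.fst h)]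
    have card_eq : #J' = #J := by linarith [two_mul_card J hJ.1, two_mul_card J' hJ'.1]
    exact inner_embeddedVector_coordProj_of_ne hV hB hk rfl card_eq

theorem range_embeddedVector_coordPacking (hS : ∀ J ∈ S, Jᶜ ∈ S) (x : Fin m) :
    Set.range (fun i => embeddedVector V (coordPacking B S i)) =
      Set.range (fun i : K × {J ∈ S | x ∈ J} => embeddedVector V (coordProj (B i.1) i.2.1)) ∪
        Set.range (-fun i : K × {J ∈ S | x ∈ J} =>
          embeddedVector V (coordProj (B i.1) i.2.1)) := by
  ext u
  constructor
  · rintro ⟨⟨k, J, hJ⟩, rfl⟩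
    by_cases hx : x ∈ J
    · exact .inl ⟨(k, ⟨J, mem_filter.2 ⟨hJ, hx⟩⟩), rfl⟩
    · refine .inr ⟨(k, ⟨Jᶜ, mem_filter.2 ⟨hS J hJ, mem_compl.2 hx⟩⟩), ?_⟩
      exact neg_eq_iff_eq_neg.2 (embeddedVector_coordProj_compl V (B k) J)
  · rintro (⟨⟨k, J, hJ⟩, rfl⟩ | ⟨⟨k, J, hJ⟩, rfl⟩)
    · exact ⟨(k, ⟨J, (mem_filter.1 hJ).1⟩), rfl⟩
    · exact ⟨(k, ⟨Jᶜ, hS J (mem_filter.1 hJ).1⟩), embeddedVector_coordProj_compl V (B k) J⟩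

theorem eq_of_inner_embeddedVector_coordProj_eq_one (hV : IsHilbertSchmidtIsometry V)
    (b : OrthonormalBasis (Fin m) 𝕜 (EuclideanSpace 𝕜 (Fin m))) {J J' : Finset (Fin m)}
    (hJ : #J = l) (hJ' : #J' = l)
    (h : inner ℝ (embeddedVector V (coordProj b J)) (embeddedVector V (coordProj b J')) = 1) :
    J' = J := by
  rw [inner_embeddedVector_coordProj hV b hJ hJ'] at h
  have m_ne_zero : (m : ℝ) ≠ 0 := NeZero.ne _
  have card_inter : #(J ∩ J') = l := by
    have : (#(J ∩ J') : ℝ) - (l : ℝ) ^ 2 / m = l * (m - l) / m := eq_of_div_eq_one h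
    have : (#(J ∩ J') : ℝ) = l := by rw [sub_eq_iff_eq_add.1 this]; field_simp; ring
    exact_mod_cast this
  have inter_eq_left : J ∩ J' = J := eq_of_subset_of_card_le inter_subset_left (by omega)
  have inter_eq_right : J ∩ J' = J' := eq_of_subset_of_card_le inter_subset_right (by omega)
  exact inter_eq_right.symm.trans inter_eq_left

theorem eq_compl_of_inner_embeddedVector_coordProj_eq_neg_one (hV : IsHilbertSchmidtIsometry V)
    (b : OrthonormalBasis (Fin m) 𝕜 (EuclideanSpace 𝕜 (Fin m))) {J J' : Finset (Fin m)}
    (hJ : #J = l) (hJ' : #J' = l)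
    (h : inner ℝ (embeddedVector V (coordProj b J)) (embeddedVector V (coordProj b J')) = -1) :
    J' = Jᶜ := by
  rw [inner_embeddedVector_coordProj hV b hJ hJ'] at h
  have m_pos : (0 : ℝ) < m := Nat.cast_pos.2 (NeZero.pos m)
  have den_ne_zero : (l : ℝ) * (m - l) / m ≠ 0 := fun h0 => by simp [h0] at h
  have l_ne_zero : l ≠ 0 := fun h0 => by simp [h0] at den_ne_zero
  have l_lt_m : (l : ℝ) < m := by
    have l_le_m : l ≤ m := hJ ▸ card_le_univ J |>.trans_eq (Fintype.card_fin m)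
    exact lt_of_le_of_ne (by exact_mod_cast l_le_m) fun h0 => by simp [h0] at den_ne_zero
  have card_inter_mul : (#(J ∩ J') : ℝ) * m = l * (2 * l - m) := by
    rw [div_eq_iff den_ne_zero] at h
    field_simp at h
    linarith
  have le_card_inter : 2 * (l : ℝ) - m ≤ #(J ∩ J') := by
    have card_union := card_union_add_card_inter J J'
    have card_union_le := (card_le_univ (J ∪ J')).trans_eq (Fintype.card_fin m)
    have : 2 * l ≤ #(J ∩ J') + m := by omega
    rw [sub_le_iff_le_add]
    exact_mod_cast this
  have two_mul_le : 2 * (l : ℝ) ≤ m := by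
    nlinarith [mul_le_mul_of_nonneg_right le_card_inter m_pos.le]
  have card_inter : #(J ∩ J') = 0 := by
    have : (#(J ∩ J') : ℝ) * m ≤ 0 :=
      card_inter_mul ▸ mul_nonpos_of_nonneg_of_nonpos l.cast_nonneg (by linarith)
    exact_mod_cast le_antisymm (nonpos_of_mul_nonpos_left this m_pos) (Nat.cast_nonneg _)
  have two_mul_eq : 2 * l = m := by
    rw [card_inter, Nat.cast_zero, zero_mul, eq_comm, mul_eq_zero] at card_inter_mul
    have := sub_eq_zero.1 (card_inter_mul.resolve_left (Nat.cast_ne_zero.2 l_ne_zero))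
    exact_mod_cast this
  exact eq_compl_of_disjoint_of_card_add_card
    (disjoint_iff_inter_eq_empty.2 (card_eq_zero.1 card_inter)) (by rw [Fintype.card_fin]; omega)

theorem compl_mem_of_formsOrthoplex [Nonempty K] (hl : ∀ J ∈ S, #J = l)
    (hV : IsHilbertSchmidtIsometry V) (hB : IsMUB B)
    (hv : FormsOrthoplex fun i => embeddedVector V (coordPacking B S i)) {J : Finset (Fin m)}
    (hJ : J ∈ S) : Jᶜ ∈ S := by
  obtain ⟨k⟩ := ‹Nonempty K›
  obtain ⟨⟨k', J', hJ'⟩, h⟩ := hv.exists_eq_neg (k, ⟨J, hJ⟩)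
  have inner_eq : inner ℝ (embeddedVector V (coordProj (B k) J))
      (embeddedVector V (coordProj (B k') J')) = -1 := by
    have unit : inner ℝ (embeddedVector V (coordProj (B k) J))
      (embeddedVector V (coordProj (B k) J)) = 1 := hv.inner_self_eq_one (k, ⟨J, hJ⟩)
    have neg : embeddedVector V (coordProj (B k') J') =
      -embeddedVector V (coordProj (B k) J) := h
    rw [neg, inner_neg_right, unit]
  obtain rfl | hk := eq_or_ne k k'
  · exact eq_compl_of_inner_embeddedVector_coordProj_eq_neg_one hV (B k) (hl J hJ) (hl J' hJ')
      inner_eq ▸ hJ'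
  · rw [inner_embeddedVector_coordProj_of_ne hV hB hk (hl J hJ) (hl J' hJ')] at inner_eq
    norm_num at inner_eq

theorem isOrthogonalHalving_of_formsOrthoplex [Nonempty K] (hl : ∀ J ∈ S, #J = l)
    (hV : IsHilbertSchmidtIsometry V) (hB : IsMUB B)
    (hv : FormsOrthoplex fun i => embeddedVector V (coordPacking B S i)) :
    IsOrthogonalHalving S := by
  have compl_mem (J) (hJ : J ∈ S) : Jᶜ ∈ S := compl_mem_of_formsOrthoplex hl hV hB hv hJ
  obtain ⟨k⟩ := ‹Nonempty K›
  have two_mul_card (J) (hJ : J ∈ S) : 2 * #J = m := by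
    have card_add_compl := card_add_card_compl J
    rw [hl _ (compl_mem J hJ), Fintype.card_fin, hl J hJ] at card_add_compl
    rw [hl J hJ]
    omega
  refine ⟨compl_mem, fun J hJ => (two_mul_card J hJ).trans (Fintype.card_fin m).symm,
    fun J hJ J' hJ' ne_block ne_compl => ?_⟩
  rcases hv.inner_eq_one_or_neg_one_or_zero (k, ⟨J, hJ⟩) (k, ⟨J', hJ'⟩) with h | h | h
  · exact absurd (eq_of_inner_embeddedVector_coordProj_eq_one hV (B k) (hl J hJ) (hl J' hJ') h)
      ne_block
  · exact absurd (eq_compl_of_inner_embeddedVector_coordProj_eq_neg_one hV (B k) (hl J hJ)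
      (hl J' hJ') h) ne_compl
  · have m_ne_zero : (m : ℝ) ≠ 0 := NeZero.ne _
    have four_mul := (inner_embeddedVector_coordProj_of_two_mul_card hV (B k) (two_mul_card J hJ)
      (two_mul_card J' hJ')).symm.trans h
    rw [sub_eq_zero, div_eq_one_iff_eq m_ne_zero] at four_mul
    rw [Fintype.card_fin]
    exact_mod_cast four_mul

theorem isMaximalOrthoplectic_coordPacking_iff [Fintype K] (hl : ∀ J ∈ S, #J = l) (hB : IsMUB B)
    (hK : (Fintype.card K : ℚ) = maxMUB 𝕜 m) :
    IsMaximalOrthoplectic (coordPacking B S) ↔ IsOrthogonalHalving S ∧ #S + 2 = 2 * m := by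
  have : Nonempty K := nonempty_of_card_eq_maxMUB hK
  have m_pos : 0 < m := NeZero.pos m
  have card_iff : Fintype.card (K × S) = 2 * embDim 𝕜 m ↔ #S + 2 = 2 * m := by
    rw [Fintype.card_prod, Fintype.card_coe, two_mul_embDim_eq_card_mul hK,
      Nat.mul_right_inj Fintype.card_ne_zero]
    omega
  rw [IsMaximalOrthoplectic, card_iff, and_comm]
  refine and_congr_left fun hcard => ⟨?_, fun hS => ?_⟩
  · rintro ⟨V, hV, hv⟩
    exact isOrthogonalHalving_of_formsOrthoplex hl hV hB hv
  · obtain ⟨V, hV⟩ := exists_isHilbertSchmidtIsometry 𝕜 m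
    have card_half : Fintype.card (K × {J ∈ S | 0 ∈ J}) = embDim 𝕜 m := by
      have two_mul_dim := card_iff.2 hcard
      rw [Fintype.card_prod, Fintype.card_coe, ← hS.two_mul_card_filter_mem 0] at two_mul_dim
      rw [Fintype.card_prod, Fintype.card_coe]
      linarith
    exact ⟨V, hV, formsOrthoplex_of_orthonormal (orthonormal_embeddedVector_coordProj hS hV hB 0)
      card_half (range_embeddedVector_coordPacking hS.compl_mem 0)⟩

end CoordinatePackings

theorem IsHadamardThreeDesign.isMaximalOrthoplectic_isConstantRank_isFusionFrame {𝕜 : Type*}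
    [RCLike 𝕜] {m : ℕ} {S : Finset (Finset (Fin m))} {K : Type*} [Fintype K]
    {B : K → OrthonormalBasis (Fin m) 𝕜 (EuclideanSpace 𝕜 (Fin m))}
    (hS : IsHadamardThreeDesign S) (hB : IsMUB B) (hK : (Fintype.card K : ℚ) = maxMUB 𝕜 m) :
    IsMaximalOrthoplectic (coordPacking B S) ∧ IsConstantRank (coordPacking B S) ∧
      IsFusionFrame (coordPacking B S) := by
  obtain ⟨hm, halving, hcard⟩ := isHadamardThreeDesign_iff.1 hS
  have : NeZero m := ⟨by omega⟩
  have : Nonempty K := nonempty_of_card_eq_maxMUB hK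
  have card_block (J) (hJ : J ∈ S) : #J = m / 2 := by
    have := halving.two_mul_card J hJ
    rw [Fintype.card_fin] at this
    omega
  have card_filter_mem (x : Fin m) : #{J ∈ S | x ∈ J} = #S / 2 := by
    have := halving.two_mul_card_filter_mem x
    omega
  exact ⟨(isMaximalOrthoplectic_coordPacking_iff card_block hB hK).2 ⟨halving, hcard⟩,
    isConstantRank_coordPacking card_block (card_pos.1 (by omega)),
    isFusionFrame_coordPacking card_filter_mem (by omega)⟩

/-! ### Affine hyperplanes over the field with two elements -/

section SignCharacter

/-- The nontrivial additive character `a ↦ (-1) ^ a` of the field with two elements, with values in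
an arbitrary ring. -/
def signChar (R : Type*) [CommRing R] : AddChar (ZMod 2) R := AddChar.zmodChar 2 neg_one_sq

variable {R : Type*} [CommRing R]

theorem signChar_eq_ite (a : ZMod 2) : signChar R a = if a = 0 then 1 else -1 := by
  obtain rfl | rfl : a = 0 ∨ a = 1 := by revert a; decide
  · simp
  · simp [signChar, AddChar.zmodChar_apply, ZMod.val_one]

theorem signChar_one : signChar R 1 = -1 := by simp [signChar_eq_ite]

variable {V : Type*} [AddCommGroup V] [Module (ZMod 2) V]

theorem sum_signChar_dual_eq_zero [IsDomain R] [NeZero (2 : R)] [Fintype V]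
    {f : Dual (ZMod 2) V} (hf : f ≠ 0) : ∑ x, signChar R (f x) = 0 := by
  refine AddChar.sum_eq_zero_of_ne_one (ψ := (signChar R).compAddMonoidHom f.toAddMonoidHom) ?_
  obtain ⟨x, hx⟩ : ∃ x, f x = 1 := LinearMap.surjective hf 1
  refine AddChar.ne_one_iff.2 ⟨x, ?_⟩
  simpa [hx, signChar_one, eq_comm, eq_neg_iff_add_eq_zero, one_add_one_eq_two] using
    NeZero.ne (2 : R)

theorem card_dual_zmod_two [Finite V] : Nat.card (Dual (ZMod 2) V) = Nat.card V :=
  (Nat.card_congr (finBasis (ZMod 2) V).toDualEquiv.toEquiv).symm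

end SignCharacter

section AffineHyperplanes

variable {V : Type*} [AddCommGroup V] [Module (ZMod 2) V] [Fintype V]

/-- The affine hyperplane on which the functional `f` takes the value `c`. -/
def affineHyperplane (f : Dual (ZMod 2) V) (c : ZMod 2) : Finset V := {x | f x = c}

variable (V) in
open Classical in
/-- All affine hyperplanes of a finite vector space over the field with two elements; they form the
Hadamard design that comes from the Sylvester matrix. -/
noncomputable def affineHyperplanes : Finset (Finset V) :=
  {H | ∃ f : Dual (ZMod 2) V, f ≠ 0 ∧ ∃ c, affineHyperplane f c = H}

theorem mem_affineHyperplanes {H : Finset V} :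
    H ∈ affineHyperplanes V ↔ ∃ f : Dual (ZMod 2) V, f ≠ 0 ∧ ∃ c, affineHyperplane f c = H := by
  simp [affineHyperplanes]

variable {f g : Dual (ZMod 2) V} {c d : ZMod 2}

theorem signOf_affineHyperplane [DecidableEq V] (x : V) :
    signOf (affineHyperplane f c) x = signChar ℤ (f x) * signChar ℤ c := by
  rw [← AddChar.map_add_eq_mul, signChar_eq_ite, signOf]
  simp only [affineHyperplane, mem_filter, mem_univ, true_and, CharTwo.add_eq_zero]

theorem compl_affineHyperplane [DecidableEq V] :
    (affineHyperplane f c)ᶜ = affineHyperplane f (c + 1) := by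
  ext x
  simp only [affineHyperplane, mem_compl, mem_filter, mem_univ, true_and]
  generalize f x = a
  revert a c
  decide

theorem two_mul_card_affineHyperplane (hf : f ≠ 0) :
    2 * #(affineHyperplane f c) = Fintype.card V := by
  classical
  have sum_eq := sum_signOf (affineHyperplane f c)
  simp only [signOf_affineHyperplane, ← sum_mul, sum_signChar_dual_eq_zero hf] at sum_eq
  omega

theorem four_mul_card_affineHyperplane_inter [DecidableEq V] (hf : f ≠ 0) (hg : g ≠ 0)
    (hfg : f ≠ g) :
    4 * #(affineHyperplane f c ∩ affineHyperplane g d) = Fintype.card V := by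
  have sum_eq := sum_signOf_mul_signOf (affineHyperplane f c) (affineHyperplane g d)
  have sign_mul (x) : signOf (affineHyperplane f c) x * signOf (affineHyperplane g d) x =
      signChar ℤ ((f - g) x) * (signChar ℤ c * signChar ℤ d) := by
    rw [signOf_affineHyperplane, signOf_affineHyperplane, LinearMap.sub_apply, CharTwo.sub_eq_add,
      AddChar.map_add_eq_mul, mul_mul_mul_comm]
  simp only [sign_mul, ← sum_mul, sum_signChar_dual_eq_zero (sub_ne_zero.2 hfg)] at sum_eq
  have card_f := two_mul_card_affineHyperplane (c := c) hf
  have card_g := two_mul_card_affineHyperplane (c := d) hg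
  omega

theorem affineHyperplane_inj (hf : f ≠ 0) (hg : g ≠ 0) :
    affineHyperplane f c = affineHyperplane g d ↔ f = g ∧ c = d := by
  classical
  refine ⟨fun h => ?_, fun h => by rw [h.1, h.2]⟩
  obtain rfl : f = g := by
    by_contra hfg
    have card_inter := four_mul_card_affineHyperplane_inter (c := c) (d := d) hf hg hfg
    rw [← h, inter_self] at card_inter
    have card_f := two_mul_card_affineHyperplane (c := c) hf
    have := Fintype.card_pos (α := V)
    omega
  obtain ⟨x, hx⟩ := LinearMap.surjective hf c
  have mem : x ∈ affineHyperplane f d := h ▸ mem_filter.2 ⟨mem_univ x, hx⟩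
  exact ⟨rfl, hx.symm.trans (mem_filter.1 mem).2⟩

theorem isOrthogonalHalving_affineHyperplanes [DecidableEq V] :
    IsOrthogonalHalving (affineHyperplanes V) where
  compl_mem := by
    intro H hH
    obtain ⟨f, hf, c, rfl⟩ := mem_affineHyperplanes.1 hH
    exact mem_affineHyperplanes.2 ⟨f, hf, c + 1, compl_affineHyperplane.symm⟩
  two_mul_card := by
    intro H hH
    obtain ⟨f, hf, c, rfl⟩ := mem_affineHyperplanes.1 hH
    exact two_mul_card_affineHyperplane hf
  four_mul_card_inter := by
    intro H hH H' hH' ne_block ne_compl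
    obtain ⟨f, hf, c, rfl⟩ := mem_affineHyperplanes.1 hH
    obtain ⟨g, hg, d, rfl⟩ := mem_affineHyperplanes.1 hH'
    refine four_mul_card_affineHyperplane_inter hf hg ?_
    rintro rfl
    rw [compl_affineHyperplane] at ne_compl
    have : d = c ∨ d = c + 1 := by clear * -; revert c d; decide
    rcases this with rfl | rfl
    exacts [ne_block rfl, ne_compl rfl]

theorem card_affineHyperplanes_add_two : #(affineHyperplanes V) + 2 = 2 * Fintype.card V := by
  have : Finite (Dual (ZMod 2) V) := Module.finite_of_finite (ZMod 2)
  have coe_eq : (affineHyperplanes V : Set (Finset V)) =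
      (fun p : Dual (ZMod 2) V × ZMod 2 => affineHyperplane p.1 p.2) '' ({0}ᶜ ×ˢ Set.univ) := by
    ext H
    simp [mem_affineHyperplanes]
  have inj : Set.InjOn (fun p : Dual (ZMod 2) V × ZMod 2 => affineHyperplane p.1 p.2)
      ({0}ᶜ ×ˢ Set.univ) := fun p hp q hq h =>
    Prod.ext_iff.2 ((affineHyperplane_inj hp.1 hq.1).1 h)
  have card_nonzero := Set.ncard_add_ncard_compl ({0} : Set (Dual (ZMod 2) V))
  rw [Set.ncard_singleton, card_dual_zmod_two, Nat.card_eq_fintype_card] at card_nonzero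
  rw [← Set.ncard_coe_finset, coe_eq, inj.ncard_image, Set.ncard_prod,
    Set.ncard_univ, Nat.card_zmod]
  omega

end AffineHyperplanes

theorem IsOrthogonalHalving.map {α β : Type*} [Fintype α] [DecidableEq α] [Fintype β]
    [DecidableEq β] {S : Finset (Finset α)} (hS : IsOrthogonalHalving S) (e : α ≃ β) :
    IsOrthogonalHalving (S.map e.finsetCongr.toEmbedding) := by
  have map_compl (J : Finset α) : Jᶜ.map e.toEmbedding = (J.map e.toEmbedding)ᶜ := by
    ext; simp
  constructor <;>
    simp only [mem_map, Equiv.coe_toEmbedding, Equiv.finsetCongr_apply, forall_exists_index,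
      and_imp, forall_apply_eq_imp_iff₂]
  · exact fun J hJ => ⟨Jᶜ, hS.compl_mem J hJ, map_compl J⟩
  · intro J hJ
    rw [card_map, hS.two_mul_card J hJ, Fintype.card_congr e]
  · intro J hJ J' hJ' ne_block ne_compl
    rw [← map_inter, card_map, ← Fintype.card_congr e]
    refine hS.four_mul_card_inter J hJ J' hJ' (ne_block <| congrArg _ ·) fun h => ne_compl ?_
    rw [h, map_compl]

theorem exists_isHadamardThreeDesign {n : ℕ} (hn : 2 ≤ n) :
    ∃ S : Finset (Finset (Fin (2 ^ n))), IsHadamardThreeDesign S := by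
  let V := Fin n → ZMod 2
  have card_V : Fintype.card V = 2 ^ n := by simp [V]
  have four_le : 2 ^ 2 ≤ 2 ^ n := Nat.pow_le_pow_right two_pos hn
  refine ⟨_, isHadamardThreeDesign_iff.2 ⟨by omega,
    isOrthogonalHalving_affineHyperplanes.map (Fintype.equivFinOfCardEq card_V), ?_⟩⟩
  rw [card_map, card_affineHyperplanes_add_two, card_V]

/-! ### Quadratic phases -/

theorem exists_eq_diagonal_add_add_flip {R M ι : Type*} [CommRing R] [AddCommGroup M] [Module R M]
    [Fintype ι] [LinearOrder ι] (b : Basis ι R M) {β : LinearMap.BilinForm R M} (hβ : β.IsSymm) :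
    ∃ τ : LinearMap.BilinForm R M,
      β = ∑ i, β (b i) (b i) • (b.coord i).smulRight (b.coord i) + (τ + τ.flip) := by
  let τ : LinearMap.BilinForm R M :=
    b.constr ℕ fun i => b.constr ℕ fun j => if j < i then β (b i) (b j) else 0
  have τ_apply (i j) : τ (b i) (b j) = if j < i then β (b i) (b j) else 0 := by
    simp only [τ, Basis.constr_basis]
  refine ⟨τ, b.ext fun i => b.ext fun j => ?_⟩
  have diagonal_apply : (∑ k, β (b k) (b k) • (b.coord k).smulRight (b.coord k)) (b i) (b j) =
      if i = j then β (b i) (b j) else 0 := by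
    rcases eq_or_ne i j with rfl | hij
    · simp [LinearMap.sum_apply, Finsupp.single_apply]
    · simp [LinearMap.sum_apply, Finsupp.single_apply, hij]
  rw [LinearMap.add_apply, LinearMap.add_apply, diagonal_apply, LinearMap.add_apply,
    LinearMap.add_apply, LinearMap.BilinForm.flip_apply, τ_apply, τ_apply, hβ.eq (b j) (b i)]
  rcases lt_trichotomy i j with h | rfl | h
  · simp [h, h.not_gt, h.ne]
  · simp
  · simp [h, h.not_gt, h.ne']

section QuadraticPhases

variable {𝕜 : Type*} [RCLike 𝕜]

theorem mul_conj_eq_one {c : 𝕜} (hc : ‖c‖ = 1) : c * starRingEnd 𝕜 c = 1 := by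
  rw [RCLike.mul_conj, hc, RCLike.ofReal_one, one_pow]

theorem norm_signChar (a : ZMod 2) : ‖signChar 𝕜 a‖ = 1 := AddChar.norm_apply _ a

theorem conj_signChar (a : ZMod 2) : starRingEnd 𝕜 (signChar 𝕜 a) = signChar 𝕜 a := by
  rw [signChar_eq_ite]; split_ifs <;> simp

theorem signChar_mul_self (a : ZMod 2) : signChar 𝕜 a * signChar 𝕜 a = 1 := by
  rw [← AddChar.map_add_eq_mul, CharTwo.add_self_eq_zero, AddChar.map_zero_eq_one]

variable {V : Type*} [AddCommGroup V] [Module (ZMod 2) V]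

/-- A unimodular function whose polarization is the sign of the bilinear form `β`. For alternating
`β` these are the signs of quadratic forms with polar form `β`; in general they are fourth roots of
unity and come from `ℤ / 4`-valued quadratic forms. -/
structure IsQuadraticPhase (β : LinearMap.BilinForm (ZMod 2) V) (φ : V → 𝕜) : Prop where
  norm_eq_one : ∀ x, ‖φ x‖ = 1
  map_add : ∀ x y, φ (x + y) = φ x * φ y * signChar 𝕜 (β x y)

theorem isQuadraticPhase_signChar_dual (f : Dual (ZMod 2) V) :
    IsQuadraticPhase 0 fun x => signChar 𝕜 (f x) where
  norm_eq_one _ := norm_signChar _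
  map_add x y := by simp [AddChar.map_add_eq_mul]

theorem isQuadraticPhase_signChar_apply_self (τ : LinearMap.BilinForm (ZMod 2) V) :
    IsQuadraticPhase (τ + τ.flip) fun x => signChar 𝕜 (τ x x) where
  norm_eq_one _ := norm_signChar _
  map_add x y := by
    simp only [map_add, LinearMap.add_apply, LinearMap.BilinForm.flip_apply,
      AddChar.map_add_eq_mul]
    ring

theorem isQuadraticPhase_ite (f : Dual (ZMod 2) V) {a : ZMod 2} {c : 𝕜}
    (hc : c * c = signChar 𝕜 a) :
    IsQuadraticPhase (a • f.smulRight f) fun x => if f x = 0 then 1 else c where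
  norm_eq_one x := by
    have norm_mul_self : ‖c‖ * ‖c‖ = 1 := by rw [← norm_mul, hc, norm_signChar]
    split_ifs
    · exact norm_one
    · nlinarith [norm_nonneg c]
  map_add x y := by
    have c_mul_c : c * c * signChar 𝕜 a = 1 := by rw [hc, signChar_mul_self]
    have zero_or_one (u : ZMod 2) : u = 0 ∨ u = 1 := by revert u; decide
    simp only [map_add, LinearMap.smul_apply, LinearMap.smulRight_apply, smul_eq_mul]
    rcases zero_or_one (f x) with hx | hx <;> rcases zero_or_one (f y) with hy | hy <;>
      simp [hx, hy, CharTwo.add_self_eq_zero, c_mul_c]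

namespace IsQuadraticPhase

variable {β β' : LinearMap.BilinForm (ZMod 2) V} {φ φ' : V → 𝕜}

theorem mul (hφ : IsQuadraticPhase β φ) (hφ' : IsQuadraticPhase β' φ') :
    IsQuadraticPhase (β + β') (φ * φ') where
  norm_eq_one x := by rw [Pi.mul_apply, norm_mul, hφ.norm_eq_one, hφ'.norm_eq_one, mul_one]
  map_add x y := by
    simp only [Pi.mul_apply, hφ.map_add, hφ'.map_add, LinearMap.add_apply, AddChar.map_add_eq_mul]
    ring

theorem prod {ι : Type*} {β : ι → LinearMap.BilinForm (ZMod 2) V} {φ : ι → V → 𝕜} (s : Finset ι)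
    (hφ : ∀ i ∈ s, IsQuadraticPhase (β i) (φ i)) :
    IsQuadraticPhase (∑ i ∈ s, β i) (∏ i ∈ s, φ i) := by
  classical
  induction s using Finset.induction_on with
  | empty => exact ⟨by simp, by simp⟩
  | insert i s hi ih =>
    rw [sum_insert hi, prod_insert hi]
    exact (hφ i (mem_insert_self i s)).mul (ih fun j hj => hφ j (mem_insert_of_mem hj))

theorem conj (hφ : IsQuadraticPhase β φ) :
    IsQuadraticPhase (-β) fun x => starRingEnd 𝕜 (φ x) where
  norm_eq_one x := by rw [RCLike.norm_conj, hφ.norm_eq_one]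
  map_add x y := by
    rw [hφ.map_add, map_mul, map_mul, conj_signChar, LinearMap.neg_apply, LinearMap.neg_apply,
      CharTwo.neg_eq]

theorem map_zero (hφ : IsQuadraticPhase β φ) : φ 0 = 1 := by
  have φ_zero_ne_zero : φ 0 ≠ 0 := norm_ne_zero_iff.1 (by rw [hφ.norm_eq_one]; exact one_ne_zero)
  have φ_zero_mul_self := hφ.map_add 0 0
  simp only [add_zero, _root_.map_zero, AddChar.map_zero_eq_one, mul_one] at φ_zero_mul_self
  exact (mul_eq_left₀ φ_zero_ne_zero).1 φ_zero_mul_self.symm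

theorem norm_sq_sum [Fintype V] (hφ : IsQuadraticPhase β φ) (hβ : β.SeparatingLeft) :
    ‖∑ x, φ x‖ ^ 2 = Fintype.card V := by
  suffices (∑ x, φ x) * starRingEnd 𝕜 (∑ x, φ x) = (Fintype.card V : 𝕜) by
    rw [RCLike.mul_conj] at this
    exact_mod_cast this
  have shifted (y u) : φ (u + y) * starRingEnd 𝕜 (φ y) = φ u * signChar 𝕜 (β u y) := by
    linear_combination starRingEnd 𝕜 (φ y) * hφ.map_add u y +
      φ u * signChar 𝕜 (β u y) * mul_conj_eq_one (hφ.norm_eq_one y)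
  calc (∑ x, φ x) * starRingEnd 𝕜 (∑ x, φ x)
      = ∑ y, ∑ x, φ x * starRingEnd 𝕜 (φ y) := by rw [map_sum, sum_mul_sum, sum_comm]
    _ = ∑ y, ∑ u, φ u * signChar 𝕜 (β u y) :=
        sum_congr rfl fun y _ => by
          rw [← Equiv.sum_comp (Equiv.addRight y)]
          simp only [Equiv.coe_addRight, shifted]
    _ = ∑ u, φ u * ∑ y, signChar 𝕜 (β u y) := by rw [sum_comm]; simp only [mul_sum]
    _ = φ 0 * ∑ y, signChar 𝕜 (β 0 y) := by
        refine sum_eq_single_of_mem 0 (mem_univ 0) fun u _ hu => ?_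
        have β_u_ne_zero : β u ≠ 0 := fun h => hu (hβ u fun y => by rw [h]; rfl)
        rw [sum_signChar_dual_eq_zero β_u_ne_zero, mul_zero]
    _ = (Fintype.card V : 𝕜) := by simp [hφ.map_zero]

end IsQuadraticPhase

theorem exists_isQuadraticPhase [Finite V] {β : LinearMap.BilinForm (ZMod 2) V} (hβ : β.IsSymm)
    (hsqrt : ∀ x, IsSquare (signChar 𝕜 (β x x))) : ∃ φ : V → 𝕜, IsQuadraticPhase β φ := by
  let b := finBasis (ZMod 2) V
  choose c hc using fun i => hsqrt (b i)
  obtain ⟨τ, hτ⟩ := exists_eq_diagonal_add_add_flip b hβ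
  rw [hτ]
  exact ⟨_, (IsQuadraticPhase.prod univ fun i _ => isQuadraticPhase_ite (b.coord i) (hc i).symm).mul
    (isQuadraticPhase_signChar_apply_self τ)⟩

end QuadraticPhases

/-! ### Mutually unbiased bases from bilinear forms -/

section PhaseVectors

variable {𝕜 : Type*} [RCLike 𝕜] {V : Type*} [AddCommGroup V] [Module (ZMod 2) V] [Fintype V]

/-- The unit vector whose coordinates are proportional to the function `φ` modulated by the sign
character of the functional `f`. For a fixed unimodular `φ` these vectors form an orthonormal basis
indexed by the dual space. -/
noncomputable def phaseVector (φ : V → 𝕜) (f : Dual (ZMod 2) V) : EuclideanSpace 𝕜 V :=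
  WithLp.toLp 2 fun x => ((√(Fintype.card V))⁻¹ : ℝ) * (φ x * signChar 𝕜 (f x))

theorem inner_phaseVector (φ φ' : V → 𝕜) (f f' : Dual (ZMod 2) V) :
    inner 𝕜 (phaseVector φ f) (phaseVector φ' f') = (Fintype.card V : 𝕜)⁻¹ *
      ∑ x, φ' x * starRingEnd 𝕜 (φ x) * signChar 𝕜 ((f + f') x) := by
  have scalar_mul_self : (((√(Fintype.card V))⁻¹ : ℝ) : 𝕜) * ((√(Fintype.card V))⁻¹ : ℝ) =
      (Fintype.card V : 𝕜)⁻¹ := by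
    rw [← RCLike.ofReal_mul, ← mul_inv, Real.mul_self_sqrt (Nat.cast_nonneg _), RCLike.ofReal_inv,
      RCLike.ofReal_natCast]
  rw [PiLp.inner_apply, mul_sum]
  refine sum_congr rfl fun x _ => ?_
  simp only [phaseVector, RCLike.inner_apply, map_mul, RCLike.conj_ofReal, conj_signChar,
    LinearMap.add_apply, AddChar.map_add_eq_mul, ← scalar_mul_self]
  ring

theorem orthonormal_phaseVector {φ : V → 𝕜} (hφ : ∀ x, ‖φ x‖ = 1) :
    Orthonormal 𝕜 (phaseVector φ) := by
  classical
  refine orthonormal_iff_ite.2 fun f g => ?_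
  simp only [inner_phaseVector, mul_conj_eq_one (hφ _), one_mul]
  split_ifs with hfg
  · have f_add_g : f + g = 0 := by rw [hfg, ZModModule.add_self]
    simp [f_add_g]
  · have f_add_g : f + g ≠ 0 := by rwa [← ZModModule.sub_eq_add, sub_ne_zero]
    rw [sum_signChar_dual_eq_zero f_add_g, mul_zero]

theorem norm_sq_inner_phaseVector {β β' : LinearMap.BilinForm (ZMod 2) V} {φ φ' : V → 𝕜}
    (hφ : IsQuadraticPhase β φ) (hφ' : IsQuadraticPhase β' φ') (h : (β' - β).SeparatingLeft)
    (f f' : Dual (ZMod 2) V) :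
    ‖inner 𝕜 (phaseVector φ f) (phaseVector φ' f')‖ ^ 2 = 1 / (Fintype.card V : ℝ) := by
  have phase := (hφ'.mul hφ.conj).mul (isQuadraticPhase_signChar_dual (f + f'))
  rw [add_zero, ← sub_eq_add_neg β' β] at phase
  have norm_sq_sum := phase.norm_sq_sum h
  simp only [Pi.mul_apply] at norm_sq_sum
  rw [inner_phaseVector, norm_mul, mul_pow, norm_sq_sum, norm_inv, RCLike.norm_natCast]
  field_simp

theorem norm_sq_inner_basisFun_phaseVector {φ : V → 𝕜} (hφ : ∀ x, ‖φ x‖ = 1) (x : V)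
    (f : Dual (ZMod 2) V) :
    ‖inner 𝕜 (EuclideanSpace.basisFun V 𝕜 x) (phaseVector φ f)‖ ^ 2 =
      1 / (Fintype.card V : ℝ) := by
  rw [EuclideanSpace.basisFun_inner, phaseVector, norm_mul, norm_mul, hφ, norm_signChar, mul_one,
    mul_one, RCLike.norm_ofReal, sq_abs, inv_pow, Real.sq_sqrt (Nat.cast_nonneg _), one_div]

end PhaseVectors

section ConstructionOfMUBs

variable {𝕜 : Type*} [RCLike 𝕜] {m : ℕ}

theorem exists_isMUB_of_orthonormal {E I K : Type*} [NormedAddCommGroup E] [InnerProductSpace 𝕜 E]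
    [FiniteDimensional 𝕜 E] [Fintype I] (hE : finrank 𝕜 E = m) (hI : Fintype.card I = m)
    {v : K → I → E} (hv : ∀ k, Orthonormal 𝕜 (v k))
    (hvv : ∀ k k', k ≠ k' → ∀ i i', ‖inner 𝕜 (v k i) (v k' i')‖ ^ 2 = 1 / (m : ℝ)) :
    ∃ B : K → OrthonormalBasis (Fin m) 𝕜 (EuclideanSpace 𝕜 (Fin m)), IsMUB B := by
  choose b hb using fun k => exists_orthonormalBasis_coe_eq (hv k) (hI.trans hE.symm)
  let σ : I ≃ Fin m := Fintype.equivFinOfCardEq hI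
  let o : OrthonormalBasis (Fin m) 𝕜 E := (stdOrthonormalBasis 𝕜 E).reindex (finCongr hE)
  refine ⟨fun k => ((b k).reindex σ).map o.repr, fun k k' hk j j' => ?_⟩
  simp only [OrthonormalBasis.map_apply, OrthonormalBasis.reindex_apply,
    LinearIsometryEquiv.inner_map_map, hb, hvv k k' hk]

theorem IsMUB.comp {K K' : Type*} {B : K → OrthonormalBasis (Fin m) 𝕜 (EuclideanSpace 𝕜 (Fin m))}
    (hB : IsMUB B) {f : K' → K} (hf : Function.Injective f) : IsMUB (B ∘ f) :=
  fun k k' hk => hB (f k) (f k') (hf.ne hk)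

theorem exists_isMUB_of_bilinForm {V Z : Type*} [AddCommGroup V] [Module (ZMod 2) V] [Fintype V]
    (hV : Fintype.card V = m) {β : Z → LinearMap.BilinForm (ZMod 2) V} (hβ : ∀ z, (β z).IsSymm)
    (hββ : ∀ z w, z ≠ w → (β z - β w).SeparatingLeft)
    (hsqrt : ∀ z x, IsSquare (signChar 𝕜 (β z x x))) :
    ∃ B : Option Z → OrthonormalBasis (Fin m) 𝕜 (EuclideanSpace 𝕜 (Fin m)), IsMUB B := by
  choose φ hφ using fun z => exists_isQuadraticPhase (hβ z) (hsqrt z)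
  let δ : V ≃ₗ[ZMod 2] Dual (ZMod 2) V := (finBasis (ZMod 2) V).toDualEquiv
  let v : Option Z → V → EuclideanSpace 𝕜 V := fun k =>
    k.elim (EuclideanSpace.basisFun V 𝕜) fun z => phaseVector (φ z) ∘ δ
  refine exists_isMUB_of_orthonormal (v := v) (by rw [finrank_euclideanSpace, hV]) hV ?_ ?_
  · rintro (_ | z)
    · exact (EuclideanSpace.basisFun V 𝕜).orthonormal
    · exact (orthonormal_phaseVector (hφ z).norm_eq_one).comp δ δ.injective
  · rw [← hV]
    rintro (_ | z) (_ | w) hzw x y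
    · exact absurd rfl hzw
    · exact norm_sq_inner_basisFun_phaseVector (hφ w).norm_eq_one x (δ y)
    · rw [norm_inner_symm]
      exact norm_sq_inner_basisFun_phaseVector (hφ z).norm_eq_one y (δ x)
    · exact norm_sq_inner_phaseVector (hφ z) (hφ w) (hββ w z fun h => hzw (h ▸ rfl)) (δ x) (δ y)

end ConstructionOfMUBs

section TraceForms

variable (K : Type*) {L : Type*} [Field K] [Field L] [Algebra K L]

/-- The symmetric bilinear form `(x, y) ↦ tr (z x y)`. -/
noncomputable def scaledTraceForm (z : L) : LinearMap.BilinForm K L :=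
  Algebra.traceForm K L ∘ₗ LinearMap.mulLeft K z

theorem scaledTraceForm_apply (z x y : L) :
    scaledTraceForm K z x y = Algebra.trace K L (z * x * y) := rfl

theorem isSymm_scaledTraceForm (z : L) : (scaledTraceForm K z).IsSymm :=
  ⟨fun x y => by simp only [scaledTraceForm_apply, mul_right_comm z x y]⟩

variable {K}

theorem eq_zero_of_trace_mul_eq_zero [FiniteDimensional K L] [Algebra.IsSeparable K L] {a : L}
    (h : ∀ y, Algebra.trace K L (a * y) = 0) : a = 0 :=
  (traceForm_nondegenerate K L).1 a h

theorem separatingLeft_scaledTraceForm_sub [FiniteDimensional K L] [Algebra.IsSeparable K L]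
    {z w : L} (hzw : z ≠ w) : (scaledTraceForm K z - scaledTraceForm K w).SeparatingLeft := by
  intro x hx
  refine (mul_eq_zero.1 (eq_zero_of_trace_mul_eq_zero (K := K) fun y => ?_)).resolve_left
    (sub_ne_zero.2 hzw)
  rw [sub_mul, sub_mul, map_sub]
  exact hx y

theorem trace_pow_card [Finite K] [Algebra.IsAlgebraic K L] (u : L) :
    Algebra.trace K L (u ^ Nat.card K) = Algebra.trace K L u := by
  have : Fintype K := Fintype.ofFinite K
  rw [Nat.card_eq_fintype_card]
  exact Algebra.trace_eq_of_algEquiv (FiniteField.frobeniusAlgEquivOfAlgebraic K L) u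

end TraceForms

theorem exists_complex_isMUB {n : ℕ} (hn : n ≠ 0) :
    ∃ B : Fin (2 ^ n + 1) → OrthonormalBasis (Fin (2 ^ n)) ℂ (EuclideanSpace ℂ (Fin (2 ^ n))),
      IsMUB B := by
  let F := GaloisField 2 n
  let _ : Fintype F := Fintype.ofFinite F
  have card_F : Fintype.card F = 2 ^ n := by
    rw [← Nat.card_eq_fintype_card, GaloisField.card 2 n hn]
  obtain ⟨B, hB⟩ := exists_isMUB_of_bilinForm (𝕜 := ℂ) card_F (isSymm_scaledTraceForm (ZMod 2))
    (fun _ _ => separatingLeft_scaledTraceForm_sub) fun _ _ => IsAlgClosed.exists_eq_mul_self _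
  let e : Fin (2 ^ n + 1) ≃ Option F :=
    Fintype.equivOfCardEq (by rw [Fintype.card_option, card_F, Fintype.card_fin])
  exact ⟨B ∘ e, hB.comp e.injective⟩

section KerdockSets

variable {F : Type*} [Field F] [Algebra (ZMod 2) F]

/-- The Kerdock set: a family of alternating bilinear forms on `F × ZMod 2`, indexed by `F`, whose
differences are nondegenerate when `F` has odd degree. -/
noncomputable def kerdockForm (z : F) : LinearMap.BilinForm (ZMod 2) (F × ZMod 2) :=
  let t : F × ZMod 2 →ₗ[ZMod 2] ZMod 2 :=
    Algebra.trace (ZMod 2) F ∘ₗ LinearMap.mulLeft (ZMod 2) z ∘ₗ LinearMap.fst _ _ _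
  let s : F × ZMod 2 →ₗ[ZMod 2] ZMod 2 := LinearMap.snd _ _ _
  (scaledTraceForm (ZMod 2) (z ^ 2)).compl₁₂ (LinearMap.fst _ _ _) (LinearMap.fst _ _ _) +
    t.smulRight t + s.smulRight t + t.smulRight s

theorem kerdockForm_apply (z : F) (x y : F × ZMod 2) :
    kerdockForm z x y = Algebra.trace (ZMod 2) F (z ^ 2 * x.1 * y.1) +
      Algebra.trace (ZMod 2) F (z * x.1) * Algebra.trace (ZMod 2) F (z * y.1) +
      x.2 * Algebra.trace (ZMod 2) F (z * y.1) + Algebra.trace (ZMod 2) F (z * x.1) * y.2 := rfl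

theorem isSymm_kerdockForm (z : F) : (kerdockForm z).IsSymm :=
  ⟨fun x y => by
    simp only [kerdockForm_apply, mul_right_comm (z ^ 2) x.1 y.1]; ring⟩

theorem kerdockForm_self [Finite F] (z : F) (x : F × ZMod 2) : kerdockForm z x x = 0 := by
  have trace_sq_mul : Algebra.trace (ZMod 2) F (z ^ 2 * x.1 * x.1) =
      Algebra.trace (ZMod 2) F (z * x.1) := by
    rw [← trace_pow_card (K := ZMod 2) (z * x.1), Nat.card_zmod]; congr 1; ring
  have mul_self_eq (a : ZMod 2) : a * a = a := by revert a; decide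
  rw [kerdockForm_apply, trace_sq_mul, mul_self_eq, CharTwo.add_self_eq_zero, zero_add, mul_comm,
    CharTwo.add_self_eq_zero]

theorem add_mul_eq_algebraMap_of_kerdockForm_eq [Finite F] {z w x : F} {a : ZMod 2} (hzw : z ≠ w)
    (htrace : Algebra.trace (ZMod 2) F (z * x) = Algebra.trace (ZMod 2) F (w * x))
    (h : ∀ y, kerdockForm z (x, a) (y, 0) = kerdockForm w (x, a) (y, 0)) :
    (z + w) * x = algebraMap (ZMod 2) F (Algebra.trace (ZMod 2) F (w * x) + a) := by
  have : CharP F 2 := charP_of_injective_algebraMap (algebraMap (ZMod 2) F).injective 2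
  have z_add_w_ne_zero : z + w ≠ 0 := by rwa [← CharTwo.sub_eq_add, sub_ne_zero]
  set c := Algebra.trace (ZMod 2) F (w * x) + a with hc
  have trace_eq_zero (y : F) :
      Algebra.trace (ZMod 2) F ((z + w) * ((z + w) * x + algebraMap (ZMod 2) F c) * y) = 0 := by
    have expand : (z + w) * ((z + w) * x + algebraMap (ZMod 2) F c) * y =
        z ^ 2 * x * y + c • (z * y) + (w ^ 2 * x * y + c • (w * y)) := by
      simp only [Algebra.smul_def]
      linear_combination z * w * x * y * (CharTwo.two_eq_zero : (2 : F) = 0)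
    have kerdock_eq := h y
    simp only [kerdockForm_apply, htrace, mul_zero, add_zero, add_assoc, ← add_mul, ← hc]
      at kerdock_eq
    rw [expand, map_add, map_add, map_add, map_smul, map_smul, smul_eq_mul, smul_eq_mul,
      kerdock_eq, CharTwo.add_self_eq_zero]
  exact CharTwo.add_eq_zero.1
    ((mul_eq_zero.1 (eq_zero_of_trace_mul_eq_zero trace_eq_zero)).resolve_left z_add_w_ne_zero)

theorem separatingLeft_kerdockForm_sub [Finite F] (hodd : Algebra.trace (ZMod 2) F 1 = 1) {z w : F}
    (hzw : z ≠ w) : (kerdockForm z - kerdockForm w).SeparatingLeft := by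
  rintro ⟨x, a⟩ hx
  have : CharP F 2 := charP_of_injective_algebraMap (algebraMap (ZMod 2) F).injective 2
  have z_add_w_ne_zero : z + w ≠ 0 := by rwa [← CharTwo.sub_eq_add, sub_ne_zero]
  have kerdock_eq (y) : kerdockForm z (x, a) y = kerdockForm w (x, a) y := sub_eq_zero.1 (hx y)
  have trace_eq : Algebra.trace (ZMod 2) F (z * x) = Algebra.trace (ZMod 2) F (w * x) := by
    simpa [kerdockForm_apply] using kerdock_eq (0, 1)
  have add_mul_x :=
    add_mul_eq_algebraMap_of_kerdockForm_eq hzw trace_eq fun y => kerdock_eq (y, 0)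
  have scalar_eq_zero : Algebra.trace (ZMod 2) F (w * x) + a = 0 := by
    have trace_add_mul_x := congrArg (Algebra.trace (ZMod 2) F) add_mul_x
    rwa [add_mul, map_add, trace_eq, CharTwo.add_self_eq_zero, Algebra.algebraMap_eq_smul_one,
      map_smul, hodd, smul_eq_mul, mul_one, eq_comm] at trace_add_mul_x
  rw [scalar_eq_zero, map_zero] at add_mul_x
  obtain rfl : x = 0 := (mul_eq_zero.1 add_mul_x).resolve_left z_add_w_ne_zero
  simpa using scalar_eq_zero

theorem trace_one_galoisField_of_odd {n : ℕ} (hn : Odd n) :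
    Algebra.trace (ZMod 2) (GaloisField 2 n) 1 = 1 := by
  rw [← map_one (algebraMap (ZMod 2) (GaloisField 2 n)), Algebra.trace_algebraMap,
    GaloisField.finrank 2 hn.pos.ne', nsmul_one, ZMod.natCast_eq_one_iff_odd]
  exact hn

theorem exists_real_isMUB {n m : ℕ} (hn : Odd n) (hm : m = 2 ^ n * 2) :
    ∃ B : Fin (m / 2 + 1) → OrthonormalBasis (Fin m) ℝ (EuclideanSpace ℝ (Fin m)), IsMUB B := by
  let F := GaloisField 2 n
  let _ : Fintype F := Fintype.ofFinite F
  have card_F : Fintype.card F = 2 ^ n := by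
    rw [← Nat.card_eq_fintype_card, GaloisField.card 2 n hn.pos.ne']
  obtain ⟨B, hB⟩ := exists_isMUB_of_bilinForm (𝕜 := ℝ) (V := F × ZMod 2) (m := m)
    (by rw [Fintype.card_prod, card_F, ZMod.card, hm]) isSymm_kerdockForm
    (fun _ _ => separatingLeft_kerdockForm_sub (trace_one_galoisField_of_odd hn))
    fun z x => by rw [kerdockForm_self, AddChar.map_zero_eq_one]; exact IsSquare.one
  let e : Fin (m / 2 + 1) ≃ Option F :=
    Fintype.equivOfCardEq (by rw [Fintype.card_option, card_F, Fintype.card_fin, hm]; simp)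
  exact ⟨B ∘ e, hB.comp e.injective⟩

end KerdockSets

end OrthoplecticFrames

theorem mainTheorem4 :
    -- the characterization, for every maximal set of mutually unbiased bases
    (∀ (𝕜 : Type*) [RCLike 𝕜] (m l : ℕ) (S : Finset (Finset (Fin m))) (K : Type*) [Fintype K]
      (B : K → OrthonormalBasis (Fin m) 𝕜 (EuclideanSpace 𝕜 (Fin m))),
      (∀ J ∈ S, J.card = l) → IsMUB B → (Fintype.card K : ℚ) = maxMUB 𝕜 m →
        (IsHadamardThreeDesign S →
          IsMaximalOrthoplectic (coordPacking B S) ∧ IsConstantRank (coordPacking B S) ∧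
            IsFusionFrame (coordPacking B S)) ∧
        (2 < m → IsMaximalOrthoplectic (coordPacking B S) → IsConstantRank (coordPacking B S) →
          IsHadamardThreeDesign S)) ∧
    -- the complex case for powers of 2
    (∀ a m : ℕ, 2 ≤ a → m = 2 ^ a →
      (∃ S : Finset (Finset (Fin m)), IsHadamardThreeDesign S) ∧
      ∃ B : Fin (m + 1) → OrthonormalBasis (Fin m) ℂ (EuclideanSpace ℂ (Fin m)),
        IsMUB B ∧ ∀ S : Finset (Finset (Fin m)), IsHadamardThreeDesign S →
          IsMaximalOrthoplectic (coordPacking B S) ∧ IsConstantRank (coordPacking B S) ∧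
            IsFusionFrame (coordPacking B S)) ∧
    -- the real case for powers of 4
    (∀ a m : ℕ, 1 ≤ a → m = 4 ^ a →
      (∃ S : Finset (Finset (Fin m)), IsHadamardThreeDesign S) ∧
      ∃ B : Fin (m / 2 + 1) → OrthonormalBasis (Fin m) ℝ (EuclideanSpace ℝ (Fin m)),
        IsMUB B ∧ ∀ S : Finset (Finset (Fin m)), IsHadamardThreeDesign S →
          IsMaximalOrthoplectic (coordPacking B S) ∧ IsConstantRank (coordPacking B S) ∧
            IsFusionFrame (coordPacking B S)) := by
  refine ⟨fun 𝕜 _ m l S K _ B hl hB hK => ⟨fun hS =>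
    hS.isMaximalOrthoplectic_isConstantRank_isFusionFrame hB hK, fun hm hP _ => ?_⟩, ?_, ?_⟩
  · have : NeZero m := ⟨by omega⟩
    exact isHadamardThreeDesign_iff.2 ⟨hm, (isMaximalOrthoplectic_coordPacking_iff hl hB hK).1 hP⟩
  · rintro a _ ha rfl
    obtain ⟨B, hB⟩ := exists_complex_isMUB (n := a) (by omega)
    have card_eq_maxMUB : (Fintype.card (Fin (2 ^ a + 1)) : ℚ) = maxMUB ℂ (2 ^ a) := by
      rw [maxMUB_complex, Fintype.card_fin, Nat.cast_add_one]
    exact ⟨exists_isHadamardThreeDesign ha, B, hB, fun S hS =>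
      hS.isMaximalOrthoplectic_isConstantRank_isFusionFrame hB card_eq_maxMUB⟩
  · rintro a m ha hm
    have hm' : m = 2 ^ (2 * a) := by rw [hm, pow_mul]; norm_num
    have two_dvd : 2 ∣ m := hm' ▸ dvd_pow_self 2 (by omega)
    obtain ⟨B, hB⟩ := exists_real_isMUB (n := 2 * a - 1) (m := m) ⟨a - 1, by omega⟩
      (by rw [hm', ← pow_succ]; congr 1; omega)
    have card_eq_maxMUB : (Fintype.card (Fin (m / 2 + 1)) : ℚ) = maxMUB ℝ m := by
      rw [maxMUB_real, Fintype.card_fin, Nat.cast_add_one, Nat.cast_div two_dvd two_ne_zero,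
        Nat.cast_two]
    refine ⟨?_, B, hB, fun S hS =>
      hS.isMaximalOrthoplectic_isConstantRank_isFusionFrame hB card_eq_maxMUB⟩
    subst hm'
    exact exists_isHadamardThreeDesign (by omega)
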